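/- \textbf{Theorem (Canonicity for a dependent type theory).} Consider Martin-L\"of type theory with the judgements ``$\Gamma$ is a context'', $\Gamma\vdash A\ \mathrm{type}$, $\Gamma\vdash A=B\ \mathrm{type}$, $\Gamma\vdash a:A$ and $\Gamma\vdash a=b:A$, derived by the usual structural, equivalence, congruence and type-conversion rules together with the following. \begin{itemize} \item Dependent products $\prod_{x:A}B$, with $\lambda$-abstraction and application satisfying $(\lambda x.t)(a)=t[x/a]$ and $f=\lambda x.f(x)$. \item Dependent sums $\sum_{x:A}B$, with pairing and projections satisfying $\pi_1(a,b)=a$, $\pi_2(a,b)=b$ and $p=(\pi_1(p),\pi_2(p))$. \item A type $\mathsf{Ans}$ with two constants $\mathsf{yes},\mathsf{no}:\mathsf{Ans}$ and no eliminator. \item A Tarski universe $\mathsf{U}$: a type $\mathsf{U}$, a type $\mathsf{El}(c)$ for each $c:\mathsf{U}$, and codes $\mathsf{ans}:\mathsf{U}$ and $\mathsf{pi}(a,x.b),\mathsf{sigma}(a,x.b):\mathsf{U}$ for $a:\mathsf{U}$ and $x:\mathsf{El}(a)\vdash b:\mathsf{U}$, with the judgemental equalities of types \[\mathsf{El}(\mathsf{ans})=\mathsf{Ans},\quad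 \mathsf{El}(\mathsf{pi}(a,x.b))=\prod_{x:\mathsf{El}(a)}\mathsf{El}(b),\quad \mathsf{El}(\mathsf{sigma}(a,x.b))=\sum_{x:\mathsf{El}(a)}\mathsf{El}(b).\] \end{itemize} Then for every closed term $\vdash t:\mathsf{Ans}$, either $\vdash t=\mathsf{yes}:\mathsf{Ans}$ or $\vdash t=\mathsf{no}:\mathsf{Ans}$ is derivable. -/

import Mathlib

/-!
Martin-Löf type theory with dependent products, dependent sums (both with `β` and `η`), an
answer type `Ans` with the two constants `yes` and `no` and no eliminator, and a Tarski universe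
`U` with decoding `El`, closed under codes for `Ans`, products and sums.

Raw syntax uses de Bruijn indices: index `0` is the most recently bound variable.
-/

namespace MLTT

/-- Raw terms. `lam`, and the second argument of `piCode` and `sigmaCode`, bind one variable. -/
inductive Tm : Type
  | var (n : ℕ)
  | yes
  | no
  | lam (t : Tm)
  | app (f a : Tm)
  | pair (a b : Tm)
  | fst (p : Tm)
  | snd (p : Tm)
  | ansCode
  | piCode (a b : Tm)
  | sigmaCode (a b : Tm)

/-- Raw types. The second argument of `pi` and `sigma` binds one variable. -/
inductive Ty : Type
  | ans
  | pi (A B : Ty)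
  | sigma (A B : Ty)
  | univ
  | el (a : Tm)

/-- Contexts; the head of the list is the type of the most recent variable, and lives over
the tail. -/
abbrev Ctx : Type := List Ty

/-- The action of a renaming under a binder. -/
def liftRen (ξ : ℕ → ℕ) : ℕ → ℕ
  | 0 => 0
  | n + 1 => ξ n + 1

/-- Capture-avoiding renaming of terms. -/
def Tm.rename : (ℕ → ℕ) → Tm → Tm
  | ξ, .var n => .var (ξ n)
  | _, .yes => .yes
  | _, .no => .no
  | ξ, .lam t => .lam (t.rename (liftRen ξ))
  | ξ, .app f a => .app (f.rename ξ) (a.rename ξ)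
  | ξ, .pair a b => .pair (a.rename ξ) (b.rename ξ)
  | ξ, .fst p => .fst (p.rename ξ)
  | ξ, .snd p => .snd (p.rename ξ)
  | _, .ansCode => .ansCode
  | ξ, .piCode a b => .piCode (a.rename ξ) (b.rename (liftRen ξ))
  | ξ, .sigmaCode a b => .sigmaCode (a.rename ξ) (b.rename (liftRen ξ))

/-- Capture-avoiding renaming of types. -/
def Ty.rename : (ℕ → ℕ) → Ty → Ty
  | _, .ans => .ans
  | ξ, .pi A B => .pi (A.rename ξ) (B.rename (liftRen ξ))
  | ξ, .sigma A B => .sigma (A.rename ξ) (B.rename (liftRen ξ))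
  | _, .univ => .univ
  | ξ, .el a => .el (a.rename ξ)

/-- Weakening of a term by one fresh variable. -/
def Tm.weaken (t : Tm) : Tm := t.rename Nat.succ

/-- Weakening of a type by one fresh variable. -/
def Ty.weaken (A : Ty) : Ty := A.rename Nat.succ

/-- The action of a simultaneous substitution under a binder. -/
def liftSub (σ : ℕ → Tm) : ℕ → Tm
  | 0 => .var 0
  | n + 1 => (σ n).weaken

/-- Capture-avoiding simultaneous substitution in terms. -/
def Tm.subst : (ℕ → Tm) → Tm → Tm
  | σ, .var n => σ n
  | _, .yes => .yes
  | _, .no => .no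
  | σ, .lam t => .lam (t.subst (liftSub σ))
  | σ, .app f a => .app (f.subst σ) (a.subst σ)
  | σ, .pair a b => .pair (a.subst σ) (b.subst σ)
  | σ, .fst p => .fst (p.subst σ)
  | σ, .snd p => .snd (p.subst σ)
  | _, .ansCode => .ansCode
  | σ, .piCode a b => .piCode (a.subst σ) (b.subst (liftSub σ))
  | σ, .sigmaCode a b => .sigmaCode (a.subst σ) (b.subst (liftSub σ))

/-- Capture-avoiding simultaneous substitution in types. -/
def Ty.subst : (ℕ → Tm) → Ty → Ty
  | _, .ans => .ans
  | σ, .pi A B => .pi (A.subst σ) (B.subst (liftSub σ))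
  | σ, .sigma A B => .sigma (A.subst σ) (B.subst (liftSub σ))
  | _, .univ => .univ
  | σ, .el a => .el (a.subst σ)

/-- The substitution sending variable `0` to `a` and variable `n + 1` to variable `n`. -/
def single (a : Tm) : ℕ → Tm
  | 0 => a
  | n + 1 => .var n

/-- `t.inst a` is `t[x/a]`, where `x` is the most recent variable. -/
def Tm.inst (t a : Tm) : Tm := t.subst (single a)

/-- `B.inst a` is `B[x/a]`, where `x` is the most recent variable. -/
def Ty.inst (B : Ty) (a : Tm) : Ty := B.subst (single a)

/-- `Lookup Γ n A`: variable `n` of the context `Γ` has type `A`, weakened to all of `Γ`. -/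
inductive Lookup : Ctx → ℕ → Ty → Prop
  | here (Γ : Ctx) (A : Ty) : Lookup (A :: Γ) 0 A.weaken
  | there (Γ : Ctx) (n : ℕ) (A B : Ty) : Lookup Γ n A → Lookup (B :: Γ) (n + 1) A.weaken

/-- The forms of judgement. -/
inductive Judgement : Type
  /-- `Γ` is a well-formed context. -/
  | ctx (Γ : Ctx)
  /-- `Γ ⊢ A type`. -/
  | ty (Γ : Ctx) (A : Ty)
  /-- `Γ ⊢ A = A' type`. -/
  | tyEq (Γ : Ctx) (A A' : Ty)
  /-- `Γ ⊢ t : A`. -/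
  | tm (Γ : Ctx) (t : Tm) (A : Ty)
  /-- `Γ ⊢ t = t' : A`. -/
  | tmEq (Γ : Ctx) (t t' : Tm) (A : Ty)

open Judgement in
/-- The derivable judgements, generated by the rules of the type theory. -/
inductive Derivable : Judgement → Prop
  -- Contexts
  | ctx_nil : Derivable (ctx [])
  | ctx_cons {Γ : Ctx} {A : Ty} :
      Derivable (ctx Γ) → Derivable (ty Γ A) → Derivable (ctx (A :: Γ))
  -- Type formation
  | ty_ans {Γ : Ctx} : Derivable (ctx Γ) → Derivable (ty Γ .ans)
  | ty_pi {Γ : Ctx} {A B : Ty} :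
      Derivable (ty Γ A) → Derivable (ty (A :: Γ) B) → Derivable (ty Γ (.pi A B))
  | ty_sigma {Γ : Ctx} {A B : Ty} :
      Derivable (ty Γ A) → Derivable (ty (A :: Γ) B) → Derivable (ty Γ (.sigma A B))
  | ty_univ {Γ : Ctx} : Derivable (ctx Γ) → Derivable (ty Γ .univ)
  | ty_el {Γ : Ctx} {a : Tm} : Derivable (tm Γ a .univ) → Derivable (ty Γ (.el a))
  -- Equality of types: equivalence relation and congruence
  | tyEq_refl {Γ : Ctx} {A : Ty} : Derivable (ty Γ A) → Derivable (tyEq Γ A A)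
  | tyEq_symm {Γ : Ctx} {A B : Ty} : Derivable (tyEq Γ A B) → Derivable (tyEq Γ B A)
  | tyEq_trans {Γ : Ctx} {A B C : Ty} :
      Derivable (tyEq Γ A B) → Derivable (tyEq Γ B C) → Derivable (tyEq Γ A C)
  | tyEq_pi {Γ : Ctx} {A A' B B' : Ty} :
      Derivable (ty Γ A) → Derivable (tyEq Γ A A') → Derivable (tyEq (A :: Γ) B B') →
      Derivable (tyEq Γ (.pi A B) (.pi A' B'))
  | tyEq_sigma {Γ : Ctx} {A A' B B' : Ty} :
      Derivable (ty Γ A) → Derivable (tyEq Γ A A') → Derivable (tyEq (A :: Γ) B B') →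
      Derivable (tyEq Γ (.sigma A B) (.sigma A' B'))
  | tyEq_el {Γ : Ctx} {a a' : Tm} :
      Derivable (tmEq Γ a a' .univ) → Derivable (tyEq Γ (.el a) (.el a'))
  -- Equality of types: decoding of the codes
  | el_ans {Γ : Ctx} : Derivable (ctx Γ) → Derivable (tyEq Γ (.el .ansCode) .ans)
  | el_pi {Γ : Ctx} {a b : Tm} :
      Derivable (tm Γ a .univ) → Derivable (tm (.el a :: Γ) b .univ) →
      Derivable (tyEq Γ (.el (.piCode a b)) (.pi (.el a) (.el b)))
  | el_sigma {Γ : Ctx} {a b : Tm} :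
      Derivable (tm Γ a .univ) → Derivable (tm (.el a :: Γ) b .univ) →
      Derivable (tyEq Γ (.el (.sigmaCode a b)) (.sigma (.el a) (.el b)))
  -- Typing of terms
  | tm_conv {Γ : Ctx} {t : Tm} {A B : Ty} :
      Derivable (tm Γ t A) → Derivable (tyEq Γ A B) → Derivable (tm Γ t B)
  | tm_var {Γ : Ctx} {n : ℕ} {A : Ty} :
      Derivable (ctx Γ) → Lookup Γ n A → Derivable (tm Γ (.var n) A)
  | tm_yes {Γ : Ctx} : Derivable (ctx Γ) → Derivable (tm Γ .yes .ans)
  | tm_no {Γ : Ctx} : Derivable (ctx Γ) → Derivable (tm Γ .no .ans)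
  | tm_lam {Γ : Ctx} {t : Tm} {A B : Ty} :
      Derivable (ty Γ A) → Derivable (ty (A :: Γ) B) → Derivable (tm (A :: Γ) t B) →
      Derivable (tm Γ (.lam t) (.pi A B))
  | tm_app {Γ : Ctx} {f a : Tm} {A B : Ty} :
      Derivable (ty Γ A) → Derivable (ty (A :: Γ) B) →
      Derivable (tm Γ f (.pi A B)) → Derivable (tm Γ a A) →
      Derivable (tm Γ (.app f a) (B.inst a))
  | tm_pair {Γ : Ctx} {a b : Tm} {A B : Ty} :
      Derivable (ty Γ A) → Derivable (ty (A :: Γ) B) →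
      Derivable (tm Γ a A) → Derivable (tm Γ b (B.inst a)) →
      Derivable (tm Γ (.pair a b) (.sigma A B))
  | tm_fst {Γ : Ctx} {p : Tm} {A B : Ty} :
      Derivable (ty Γ A) → Derivable (ty (A :: Γ) B) →
      Derivable (tm Γ p (.sigma A B)) → Derivable (tm Γ (.fst p) A)
  | tm_snd {Γ : Ctx} {p : Tm} {A B : Ty} :
      Derivable (ty Γ A) → Derivable (ty (A :: Γ) B) →
      Derivable (tm Γ p (.sigma A B)) → Derivable (tm Γ (.snd p) (B.inst (.fst p)))
  | tm_ansCode {Γ : Ctx} : Derivable (ctx Γ) → Derivable (tm Γ .ansCode .univ)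
  | tm_piCode {Γ : Ctx} {a b : Tm} :
      Derivable (tm Γ a .univ) → Derivable (tm (.el a :: Γ) b .univ) →
      Derivable (tm Γ (.piCode a b) .univ)
  | tm_sigmaCode {Γ : Ctx} {a b : Tm} :
      Derivable (tm Γ a .univ) → Derivable (tm (.el a :: Γ) b .univ) →
      Derivable (tm Γ (.sigmaCode a b) .univ)
  -- Equality of terms: equivalence relation, conversion and congruence
  | tmEq_refl {Γ : Ctx} {t : Tm} {A : Ty} :
      Derivable (tm Γ t A) → Derivable (tmEq Γ t t A)
  | tmEq_symm {Γ : Ctx} {t s : Tm} {A : Ty} :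
      Derivable (tmEq Γ t s A) → Derivable (tmEq Γ s t A)
  | tmEq_trans {Γ : Ctx} {t s r : Tm} {A : Ty} :
      Derivable (tmEq Γ t s A) → Derivable (tmEq Γ s r A) → Derivable (tmEq Γ t r A)
  | tmEq_conv {Γ : Ctx} {t s : Tm} {A B : Ty} :
      Derivable (tmEq Γ t s A) → Derivable (tyEq Γ A B) → Derivable (tmEq Γ t s B)
  | tmEq_lam {Γ : Ctx} {t t' : Tm} {A B : Ty} :
      Derivable (ty Γ A) → Derivable (ty (A :: Γ) B) → Derivable (tmEq (A :: Γ) t t' B) →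
      Derivable (tmEq Γ (.lam t) (.lam t') (.pi A B))
  | tmEq_app {Γ : Ctx} {f f' a a' : Tm} {A B : Ty} :
      Derivable (ty Γ A) → Derivable (ty (A :: Γ) B) →
      Derivable (tmEq Γ f f' (.pi A B)) → Derivable (tmEq Γ a a' A) →
      Derivable (tmEq Γ (.app f a) (.app f' a') (B.inst a))
  | tmEq_pair {Γ : Ctx} {a a' b b' : Tm} {A B : Ty} :
      Derivable (ty Γ A) → Derivable (ty (A :: Γ) B) →
      Derivable (tmEq Γ a a' A) → Derivable (tmEq Γ b b' (B.inst a)) →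
      Derivable (tmEq Γ (.pair a b) (.pair a' b') (.sigma A B))
  | tmEq_fst {Γ : Ctx} {p p' : Tm} {A B : Ty} :
      Derivable (ty Γ A) → Derivable (ty (A :: Γ) B) →
      Derivable (tmEq Γ p p' (.sigma A B)) → Derivable (tmEq Γ (.fst p) (.fst p') A)
  | tmEq_snd {Γ : Ctx} {p p' : Tm} {A B : Ty} :
      Derivable (ty Γ A) → Derivable (ty (A :: Γ) B) →
      Derivable (tmEq Γ p p' (.sigma A B)) →
      Derivable (tmEq Γ (.snd p) (.snd p') (B.inst (.fst p)))
  | tmEq_piCode {Γ : Ctx} {a a' b b' : Tm} :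
      Derivable (tm Γ a .univ) → Derivable (tmEq Γ a a' .univ) →
      Derivable (tmEq (.el a :: Γ) b b' .univ) →
      Derivable (tmEq Γ (.piCode a b) (.piCode a' b') .univ)
  | tmEq_sigmaCode {Γ : Ctx} {a a' b b' : Tm} :
      Derivable (tm Γ a .univ) → Derivable (tmEq Γ a a' .univ) →
      Derivable (tmEq (.el a :: Γ) b b' .univ) →
      Derivable (tmEq Γ (.sigmaCode a b) (.sigmaCode a' b') .univ)
  -- Equality of terms: `β` and `η`
  | pi_beta {Γ : Ctx} {t a : Tm} {A B : Ty} :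
      Derivable (ty Γ A) → Derivable (ty (A :: Γ) B) →
      Derivable (tm (A :: Γ) t B) → Derivable (tm Γ a A) →
      Derivable (tmEq Γ (.app (.lam t) a) (t.inst a) (B.inst a))
  | pi_eta {Γ : Ctx} {f : Tm} {A B : Ty} :
      Derivable (ty Γ A) → Derivable (ty (A :: Γ) B) →
      Derivable (tm Γ f (.pi A B)) →
      Derivable (tmEq Γ (.lam (.app f.weaken (.var 0))) f (.pi A B))
  | sigma_beta_fst {Γ : Ctx} {a b : Tm} {A B : Ty} :
      Derivable (ty Γ A) → Derivable (ty (A :: Γ) B) →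
      Derivable (tm Γ a A) → Derivable (tm Γ b (B.inst a)) →
      Derivable (tmEq Γ (.fst (.pair a b)) a A)
  | sigma_beta_snd {Γ : Ctx} {a b : Tm} {A B : Ty} :
      Derivable (ty Γ A) → Derivable (ty (A :: Γ) B) →
      Derivable (tm Γ a A) → Derivable (tm Γ b (B.inst a)) →
      Derivable (tmEq Γ (.snd (.pair a b)) b (B.inst a))
  | sigma_eta {Γ : Ctx} {p : Tm} {A B : Ty} :
      Derivable (ty Γ A) → Derivable (ty (A :: Γ) B) →
      Derivable (tm Γ p (.sigma A B)) →
      Derivable (tmEq Γ (.pair (.fst p) (.snd p)) p (.sigma A B))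

end MLTT

namespace MLTT

/-! ### Raw substitution -/

/-! This is a Tait-style computability argument with binary relations. Each computable closed type
carries a partial equivalence relation on raw terms. At `Ans` it asks for judgemental equality, and
equality with `yes` or `no`; at a product, related arguments must give related results; at a sum,
the projections are compared. The fundamental theorem `Derivable.valid` says that derivable
judgements are respected by related closing substitutions. For a closed term of type `Ans`, the
identity substitution then yields membership in `AnsRel`, which contains the conclusion.

The universe threatens circularity, since its relation compares the relations of decoded types. No
code decodes to `U`, so two levels suffice: `Interp ∅`, whose clause for `U` is void, interprets
decoded types and defines `UnivRel`; `Interp {UnivRel}` then interprets all types. `Interp` is an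
inductive graph, and determinism of weak head reduction makes it functional
(`Interp.isPer_and_unique`).

Computable equality of types is equality of their relations, so conversion is mere transport. The
relation at a product does not ask for judgemental equality, so derivable equations are carried
separately wherever fibres or types must be compared. A reduction step of types is likewise stored
with its equation. Neither subject reduction nor injectivity of products is needed: the syntactic
input is substitution, its congruence, and presuppositions. Functions and pairs are observed only
through application and projection, so η follows from closure under weak head expansion
(`Interp.expand`). -/

theorem liftSub_var_comp (ξ : ℕ → ℕ) :
    liftSub (fun n => .var (ξ n)) = fun n => .var (liftRen ξ n) := by
  funext n; cases n <;> rfl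

theorem Tm.rename_eq_subst (t : Tm) :
    ∀ ξ : ℕ → ℕ, t.rename ξ = t.subst (fun n => .var (ξ n)) := by
  induction t <;> intro ξ <;> simp_all [Tm.rename, Tm.subst, liftSub_var_comp]

theorem Ty.rename_eq_subst (A : Ty) :
    ∀ ξ : ℕ → ℕ, A.rename ξ = A.subst (fun n => .var (ξ n)) := by
  induction A <;> intro ξ <;>
    simp_all [Ty.rename, Ty.subst, liftSub_var_comp, Tm.rename_eq_subst]

theorem liftSub_liftRen (σ : ℕ → Tm) (ξ : ℕ → ℕ) :
    (fun n => liftSub σ (liftRen ξ n)) = liftSub (fun n => σ (ξ n)) := by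
  funext n; cases n <;> rfl

theorem Tm.subst_rename_left (t : Tm) :
    ∀ (ξ : ℕ → ℕ) (σ : ℕ → Tm), (t.rename ξ).subst σ = t.subst (fun n => σ (ξ n)) := by
  induction t <;> intro ξ σ <;> simp_all [Tm.rename, Tm.subst, liftSub_liftRen]

theorem liftSub_rename (σ : ℕ → Tm) (ξ : ℕ → ℕ) :
    (fun n => (liftSub σ n).rename (liftRen ξ)) = liftSub (fun n => (σ n).rename ξ) := by
  funext n
  cases n with
  | zero => rfl
  | succ n =>
    simp only [liftSub, Tm.weaken]
    rw [Tm.rename_eq_subst _ (liftRen ξ), Tm.subst_rename_left, Tm.rename_eq_subst _ Nat.succ,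
      Tm.subst_rename_left]
    rfl

theorem Tm.rename_subst (t : Tm) :
    ∀ (σ : ℕ → Tm) (ξ : ℕ → ℕ), (t.subst σ).rename ξ = t.subst (fun n => (σ n).rename ξ) := by
  induction t <;> intro σ ξ <;> simp_all [Tm.rename, Tm.subst, liftSub_rename]

/-- Weakening is a renaming, so moving it past `τ` takes both mixed laws for renaming and
substitution; hence those laws come before composition of substitutions. -/
theorem liftSub_subst (σ τ : ℕ → Tm) :
    (fun n => (liftSub σ n).subst (liftSub τ)) = liftSub (fun n => (σ n).subst τ) := by
  funext n
  cases n with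
  | zero => rfl
  | succ n => simp only [liftSub, Tm.weaken, Tm.subst_rename_left, Tm.rename_subst]

theorem Tm.subst_subst (t : Tm) :
    ∀ σ τ : ℕ → Tm, (t.subst σ).subst τ = t.subst (fun n => (σ n).subst τ) := by
  induction t <;> intro σ τ <;> simp_all [Tm.subst, liftSub_subst]

theorem Ty.subst_subst (A : Ty) :
    ∀ σ τ : ℕ → Tm, (A.subst σ).subst τ = A.subst (fun n => (σ n).subst τ) := by
  induction A <;> intro σ τ <;> simp_all [Ty.subst, liftSub_subst, Tm.subst_subst]

theorem liftSub_var : liftSub .var = .var := by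
  funext n; cases n <;> rfl

theorem Tm.subst_var (t : Tm) : t.subst .var = t := by
  induction t <;> simp_all [Tm.subst, liftSub_var]

theorem Ty.subst_var (A : Ty) : A.subst .var = A := by
  induction A <;> simp_all [Ty.subst, liftSub_var, Tm.subst_var]

/-- Extension of a substitution by a value for variable `0`. -/
def scons (a : Tm) (σ : ℕ → Tm) : ℕ → Tm
  | 0 => a
  | n + 1 => σ n

theorem single_eq_scons (a : Tm) : single a = scons a .var := by
  funext n; cases n <;> rfl

theorem Tm.weaken_subst_scons (t a : Tm) (σ : ℕ → Tm) :
    t.weaken.subst (scons a σ) = t.subst σ :=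
  Tm.subst_rename_left ..

theorem Ty.weaken_subst (A : Ty) (σ : ℕ → Tm) :
    A.weaken.subst σ = A.subst (fun n => σ (n + 1)) := by
  rw [Ty.weaken, Ty.rename_eq_subst, Ty.subst_subst]; rfl

theorem Ty.weaken_subst_scons (A : Ty) (a : Tm) (σ : ℕ → Tm) :
    A.weaken.subst (scons a σ) = A.subst σ :=
  Ty.weaken_subst ..

theorem Tm.weaken_subst_liftSub (t : Tm) (σ : ℕ → Tm) :
    t.weaken.subst (liftSub σ) = (t.subst σ).weaken := by
  rw [Tm.weaken, Tm.subst_rename_left, Tm.weaken, Tm.rename_subst]; rfl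

theorem Ty.weaken_subst_liftSub (A : Ty) (σ : ℕ → Tm) :
    A.weaken.subst (liftSub σ) = (A.subst σ).weaken := by
  rw [Ty.weaken_subst, Ty.weaken, Ty.rename_eq_subst, Ty.subst_subst]
  congr 1; funext n
  rw [← Tm.rename_eq_subst]; rfl

/-- The weakening introduced by `liftSub` is cancelled by `single`. The extended form is the one
that closing substitutions take in the computability argument. -/
theorem liftSub_subst_single (σ : ℕ → Tm) (a : Tm) :
    (fun n => (liftSub σ n).subst (single a)) = scons a σ := by
  funext n
  cases n with
  | zero => rfl
  | succ n =>
    simp only [liftSub, single_eq_scons, Tm.weaken_subst_scons, Tm.subst_var]; rfl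

theorem single_subst (σ : ℕ → Tm) (a : Tm) :
    (fun n => (single a n).subst σ) = scons (a.subst σ) σ := by
  funext n; cases n <;> rfl

theorem Tm.subst_liftSub_inst (t a : Tm) (σ : ℕ → Tm) :
    (t.subst (liftSub σ)).inst a = t.subst (scons a σ) := by
  rw [Tm.inst, Tm.subst_subst, liftSub_subst_single]

theorem Ty.subst_liftSub_inst (B : Ty) (a : Tm) (σ : ℕ → Tm) :
    (B.subst (liftSub σ)).inst a = B.subst (scons a σ) := by
  rw [Ty.inst, Ty.subst_subst, liftSub_subst_single]

theorem Tm.inst_subst (t a : Tm) (σ : ℕ → Tm) :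
    (t.inst a).subst σ = t.subst (scons (a.subst σ) σ) := by
  rw [Tm.inst, Tm.subst_subst, single_subst]

theorem Ty.inst_subst (B : Ty) (a : Tm) (σ : ℕ → Tm) :
    (B.inst a).subst σ = B.subst (scons (a.subst σ) σ) := by
  rw [Ty.inst, Ty.subst_subst, single_subst]

theorem Tm.inst_subst' (t a : Tm) (σ : ℕ → Tm) :
    (t.inst a).subst σ = (t.subst (liftSub σ)).inst (a.subst σ) := by
  rw [Tm.inst_subst, Tm.subst_liftSub_inst]

theorem Ty.inst_subst' (B : Ty) (a : Tm) (σ : ℕ → Tm) :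
    (B.inst a).subst σ = (B.subst (liftSub σ)).inst (a.subst σ) := by
  rw [Ty.inst_subst, Ty.subst_liftSub_inst]

/-! ### Closure of the judgements under substitution -/

/-- The context of a judgement. -/
def Judgement.context : Judgement → Ctx
  | .ctx Γ => Γ
  | .ty Γ _ => Γ
  | .tyEq Γ _ _ => Γ
  | .tm Γ _ _ => Γ
  | .tmEq Γ _ _ _ => Γ

/-- The action of a substitution with target context `Δ` on judgements. -/
def Judgement.subst (Δ : Ctx) (σ : ℕ → Tm) : Judgement → Judgement
  | .ctx _ => .ctx Δ
  | .ty _ A => .ty Δ (A.subst σ)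
  | .tyEq _ A B => .tyEq Δ (A.subst σ) (B.subst σ)
  | .tm _ t A => .tm Δ (t.subst σ) (A.subst σ)
  | .tmEq _ t s A => .tmEq Δ (t.subst σ) (s.subst σ) (A.subst σ)

/-- A class of typed substitutions stable under binders. -/
structure IsSubstClass (K : Ctx → Ctx → (ℕ → Tm) → Prop) : Prop where
  ctx {Δ Γ : Ctx} {σ : ℕ → Tm} : K Δ Γ σ → Derivable (.ctx Δ)
  tm_of_lookup {Δ Γ : Ctx} {σ : ℕ → Tm} {n : ℕ} {A : Ty} : K Δ Γ σ →
    Lookup Γ n A → Derivable (.tm Δ (σ n) (A.subst σ))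
  lift {Δ Γ : Ctx} {σ : ℕ → Tm} {A : Ty} : K Δ Γ σ → Derivable (.ty Δ (A.subst σ)) →
    K (A.subst σ :: Δ) (A :: Γ) (liftSub σ)

open Derivable

/-- Passing under a binder weakens the substituted terms, so substitution presupposes weakening.
Abstracting the class lets one induction serve twice: for renamings, whose lifting needs no
weakening of derivations, and then for `WfSubst`, whose lifting uses the weakening so obtained. -/
theorem Derivable.subst_of_class {K : Ctx → Ctx → (ℕ → Tm) → Prop} (hK : IsSubstClass K)
    {J : Judgement} (h : Derivable J) :
    ∀ {Δ : Ctx} {σ : ℕ → Tm}, K Δ J.context σ → Derivable (J.subst Δ σ) := by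
  induction h <;> intro Δ σ k <;> have hΔ := hK.ctx k <;>
    simp only [Judgement.subst, Judgement.context, Ty.subst, Tm.subst, Ty.inst_subst',
      Tm.inst_subst', Tm.weaken_subst_liftSub] at *
  case ctx_nil => exact hΔ
  case ctx_cons => exact hΔ
  case ty_ans => exact ty_ans hΔ
  case ty_pi ihA ihB => exact ty_pi (ihA k) (ihB (hK.lift k (ihA k)))
  case ty_sigma ihA ihB => exact ty_sigma (ihA k) (ihB (hK.lift k (ihA k)))
  case ty_univ => exact ty_univ hΔ
  case ty_el ih => exact ty_el (ih k)
  case tyEq_refl ih => exact tyEq_refl (ih k)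
  case tyEq_symm ih => exact tyEq_symm (ih k)
  case tyEq_trans ih₁ ih₂ => exact tyEq_trans (ih₁ k) (ih₂ k)
  case tyEq_pi ihA ihE ihB => exact tyEq_pi (ihA k) (ihE k) (ihB (hK.lift k (ihA k)))
  case tyEq_sigma ihA ihE ihB => exact tyEq_sigma (ihA k) (ihE k) (ihB (hK.lift k (ihA k)))
  case tyEq_el ih => exact tyEq_el (ih k)
  case el_ans => exact el_ans hΔ
  case el_pi iha ihb => exact el_pi (iha k) (ihb (hK.lift (A := .el _) k (ty_el (iha k))))
  case el_sigma iha ihb => exact el_sigma (iha k) (ihb (hK.lift (A := .el _) k (ty_el (iha k))))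
  case tm_conv iht ihE => exact tm_conv (iht k) (ihE k)
  case tm_var hn _ => exact hK.tm_of_lookup k hn
  case tm_yes => exact tm_yes hΔ
  case tm_no => exact tm_no hΔ
  case tm_lam ihA ihB iht =>
    have k' := hK.lift k (ihA k)
    exact tm_lam (ihA k) (ihB k') (iht k')
  case tm_app ihA ihB ihf iha =>
    exact tm_app (ihA k) (ihB (hK.lift k (ihA k))) (ihf k) (iha k)
  case tm_pair ihA ihB iha ihb =>
    exact tm_pair (ihA k) (ihB (hK.lift k (ihA k))) (iha k) (ihb k)
  case tm_fst ihA ihB ihp => exact tm_fst (ihA k) (ihB (hK.lift k (ihA k))) (ihp k)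
  case tm_snd ihA ihB ihp => exact tm_snd (ihA k) (ihB (hK.lift k (ihA k))) (ihp k)
  case tm_ansCode => exact tm_ansCode hΔ
  case tm_piCode iha ihb => exact tm_piCode (iha k) (ihb (hK.lift (A := .el _) k (ty_el (iha k))))
  case tm_sigmaCode iha ihb => exact tm_sigmaCode (iha k) (ihb (hK.lift (A := .el _) k (ty_el (iha k))))
  case tmEq_refl ih => exact tmEq_refl (ih k)
  case tmEq_symm ih => exact tmEq_symm (ih k)
  case tmEq_trans ih₁ ih₂ => exact tmEq_trans (ih₁ k) (ih₂ k)
  case tmEq_conv iht ihE => exact tmEq_conv (iht k) (ihE k)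
  case tmEq_lam ihA ihB iht =>
    have k' := hK.lift k (ihA k)
    exact tmEq_lam (ihA k) (ihB k') (iht k')
  case tmEq_app ihA ihB ihf iha =>
    exact tmEq_app (ihA k) (ihB (hK.lift k (ihA k))) (ihf k) (iha k)
  case tmEq_pair ihA ihB iha ihb =>
    exact tmEq_pair (ihA k) (ihB (hK.lift k (ihA k))) (iha k) (ihb k)
  case tmEq_fst ihA ihB ihp => exact tmEq_fst (ihA k) (ihB (hK.lift k (ihA k))) (ihp k)
  case tmEq_snd ihA ihB ihp => exact tmEq_snd (ihA k) (ihB (hK.lift k (ihA k))) (ihp k)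
  case tmEq_piCode iha ihE ihb =>
    exact tmEq_piCode (iha k) (ihE k) (ihb (hK.lift (A := .el _) k (ty_el (iha k))))
  case tmEq_sigmaCode iha ihE ihb =>
    exact tmEq_sigmaCode (iha k) (ihE k) (ihb (hK.lift (A := .el _) k (ty_el (iha k))))
  case pi_beta ihA ihB iht iha =>
    have k' := hK.lift k (ihA k)
    exact pi_beta (ihA k) (ihB k') (iht k') (iha k)
  case pi_eta ihA ihB ihf => exact pi_eta (ihA k) (ihB (hK.lift k (ihA k))) (ihf k)
  case sigma_beta_fst ihA ihB iha ihb =>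
    exact sigma_beta_fst (ihA k) (ihB (hK.lift k (ihA k))) (iha k) (ihb k)
  case sigma_beta_snd ihA ihB iha ihb =>
    exact sigma_beta_snd (ihA k) (ihB (hK.lift k (ihA k))) (iha k) (ihb k)
  case sigma_eta ihA ihB ihp => exact sigma_eta (ihA k) (ihB (hK.lift k (ihA k))) (ihp k)

theorem isSubstClass_renaming : IsSubstClass fun Δ Γ σ => Derivable (.ctx Δ) ∧
    ∃ ξ : ℕ → ℕ, σ = (fun n => .var (ξ n)) ∧
      ∀ n A, Lookup Γ n A → Lookup Δ (ξ n) (A.subst σ) where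
  ctx h := h.1
  tm_of_lookup := by
    rintro Δ Γ _ n A ⟨hΔ, ξ, rfl, h⟩ hn
    exact tm_var hΔ (h n A hn)
  lift := by
    rintro Δ Γ _ A ⟨hΔ, ξ, rfl, h⟩ hA
    refine ⟨ctx_cons hΔ hA, liftRen ξ, liftSub_var_comp ξ, ?_⟩
    intro n B hn
    cases hn with
    | here => rw [Ty.weaken_subst_liftSub]; exact .here ..
    | there _ n B _ hn => rw [Ty.weaken_subst_liftSub]; exact .there _ _ _ _ (h n B hn)

theorem Derivable.weaken {J : Judgement} (h : Derivable J) {A : Ty}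
    (hA : Derivable (.ctx (A :: J.context))) :
    Derivable (J.subst (A :: J.context) (fun n => .var n.succ)) := by
  refine h.subst_of_class isSubstClass_renaming ⟨hA, Nat.succ, rfl, fun n B hn => ?_⟩
  rw [← Ty.rename_eq_subst]
  exact .there _ _ _ _ hn

theorem Derivable.tm_weaken {Γ : Ctx} {t : Tm} {A B : Ty} (h : Derivable (.tm Γ t A))
    (hB : Derivable (.ctx (B :: Γ))) : Derivable (.tm (B :: Γ) t.weaken A.weaken) := by
  simpa [Judgement.subst, Judgement.context, Tm.weaken, Ty.weaken, Tm.rename_eq_subst,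
    Ty.rename_eq_subst] using h.weaken hB

theorem Derivable.tmEq_weaken {Γ : Ctx} {t s : Tm} {A B : Ty} (h : Derivable (.tmEq Γ t s A))
    (hB : Derivable (.ctx (B :: Γ))) :
    Derivable (.tmEq (B :: Γ) t.weaken s.weaken A.weaken) := by
  simpa [Judgement.subst, Judgement.context, Tm.weaken, Ty.weaken, Tm.rename_eq_subst,
    Ty.rename_eq_subst] using h.weaken hB

theorem Derivable.tyEq_weaken {Γ : Ctx} {A A' B : Ty} (h : Derivable (.tyEq Γ A A'))
    (hB : Derivable (.ctx (B :: Γ))) : Derivable (.tyEq (B :: Γ) A.weaken A'.weaken) := by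
  simpa [Judgement.subst, Judgement.context, Ty.weaken, Ty.rename_eq_subst] using h.weaken hB

/-- `σ` is a well-typed substitution from `Γ` to `Δ`. -/
structure WfSubst (Δ Γ : Ctx) (σ : ℕ → Tm) : Prop where
  ctx : Derivable (.ctx Δ)
  tm {n : ℕ} {A : Ty} : Lookup Γ n A → Derivable (.tm Δ (σ n) (A.subst σ))

theorem tm_var_zero {Γ : Ctx} {A : Ty} (h : Derivable (.ctx (A :: Γ))) :
    Derivable (.tm (A :: Γ) (.var 0) A.weaken) :=
  tm_var h (.here ..)

theorem isSubstClass_wfSubst : IsSubstClass WfSubst where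
  ctx h := h.ctx
  tm_of_lookup h := h.tm
  lift := by
    intro Δ Γ σ A h hA
    have hA' := ctx_cons h.ctx hA
    refine ⟨hA', fun hn => ?_⟩
    cases hn with
    | here => rw [Ty.weaken_subst_liftSub]; exact tm_var_zero hA'
    | there _ n B _ hn => rw [Ty.weaken_subst_liftSub]; exact (h.tm hn).tm_weaken hA'

theorem WfSubst.lift {Δ Γ : Ctx} {σ : ℕ → Tm} {A : Ty} (h : WfSubst Δ Γ σ)
    (hA : Derivable (.ty Δ (A.subst σ))) : WfSubst (A.subst σ :: Δ) (A :: Γ) (liftSub σ) :=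
  isSubstClass_wfSubst.lift h hA

/-- The substitution theorem. -/
theorem Derivable.subst {J : Judgement} (h : Derivable J) {Δ : Ctx} {σ : ℕ → Tm}
    (k : WfSubst Δ J.context σ) : Derivable (J.subst Δ σ) :=
  h.subst_of_class isSubstClass_wfSubst k

theorem WfSubst.scons {Δ Γ : Ctx} {σ : ℕ → Tm} {A : Ty} {a : Tm} (h : WfSubst Δ Γ σ)
    (ha : Derivable (.tm Δ a (A.subst σ))) : WfSubst Δ (A :: Γ) (scons a σ) := by
  refine ⟨h.ctx, fun hn => ?_⟩
  cases hn with
  | here => rw [Ty.weaken_subst_scons]; exact ha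
  | there _ n B _ hn => rw [Ty.weaken_subst_scons]; exact h.tm hn

theorem WfSubst.var {Γ : Ctx} (h : Derivable (.ctx Γ)) : WfSubst Γ Γ .var :=
  ⟨h, fun hn => by rw [Ty.subst_var]; exact tm_var h hn⟩

theorem WfSubst.single {Γ : Ctx} {A : Ty} {a : Tm} (h : Derivable (.ctx Γ))
    (ha : Derivable (.tm Γ a A)) : WfSubst Γ (A :: Γ) (single a) := by
  rw [single_eq_scons]
  exact (WfSubst.var h).scons (by rwa [Ty.subst_var])

theorem Derivable.ctx_context {J : Judgement} (h : Derivable J) :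
    Derivable (.ctx J.context) := by
  induction h
  case ctx_nil => exact ctx_nil
  case ctx_cons h hA _ _ => exact ctx_cons h hA
  all_goals assumption

/-! ### Congruence of substitution -/

/-- `σ` and `τ` are judgementally equal well-typed substitutions from `Γ` to `Δ`. -/
structure EqSubst (Δ Γ : Ctx) (σ τ : ℕ → Tm) : Prop where
  left : WfSubst Δ Γ σ
  right : WfSubst Δ Γ τ
  tmEq {n : ℕ} {A : Ty} : Lookup Γ n A → Derivable (.tmEq Δ (σ n) (τ n) (A.subst σ))

theorem EqSubst.refl {Δ Γ : Ctx} {σ : ℕ → Tm} (h : WfSubst Δ Γ σ) : EqSubst Δ Γ σ σ :=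
  ⟨h, h, fun hn => tmEq_refl (h.tm hn)⟩

/-- Both lifts target the context extended by `A.subst σ`, so on the right variable `0` has to be
converted along `e`. In `Derivable.respectsEqSubst` this equation comes from the induction
hypothesis. -/
theorem EqSubst.lift {Δ Γ : Ctx} {σ τ : ℕ → Tm} {A : Ty} (h : EqSubst Δ Γ σ τ)
    (hA : Derivable (.ty Γ A)) (e : Derivable (.tyEq Δ (A.subst σ) (A.subst τ))) :
    EqSubst (A.subst σ :: Δ) (A :: Γ) (liftSub σ) (liftSub τ) := by
  have hA' := ctx_cons h.left.ctx (hA.subst h.left)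
  refine ⟨h.left.lift (hA.subst h.left), ⟨hA', fun hn => ?_⟩, fun hn => ?_⟩
  · cases hn with
    | here =>
      rw [Ty.weaken_subst_liftSub]
      exact tm_conv (tm_var_zero hA') (e.tyEq_weaken hA')
    | there _ n B _ hn =>
      rw [Ty.weaken_subst_liftSub]
      exact (h.right.tm hn).tm_weaken hA'
  · cases hn with
    | here => rw [Ty.weaken_subst_liftSub]; exact tmEq_refl (tm_var_zero hA')
    | there _ n B _ hn => rw [Ty.weaken_subst_liftSub]; exact (h.tmEq hn).tmEq_weaken hA'

theorem EqSubst.scons {Δ Γ : Ctx} {σ τ : ℕ → Tm} {A : Ty} {a b : Tm} (h : EqSubst Δ Γ σ τ)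
    (ha : Derivable (.tm Δ a (A.subst σ))) (hb : Derivable (.tm Δ b (A.subst τ)))
    (e : Derivable (.tmEq Δ a b (A.subst σ))) :
    EqSubst Δ (A :: Γ) (scons a σ) (scons b τ) := by
  refine ⟨h.left.scons ha, h.right.scons hb, fun hn => ?_⟩
  cases hn with
  | here => rw [Ty.weaken_subst_scons]; exact e
  | there _ n B _ hn => rw [Ty.weaken_subst_scons]; exact h.tmEq hn

/-- The statement that `J` respects judgemental equality of substitutions. -/
def Judgement.RespectsEqSubst : Judgement → Prop
  | .ty Γ A => ∀ {Δ : Ctx} {σ τ : ℕ → Tm}, EqSubst Δ Γ σ τ →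
      Derivable (.tyEq Δ (A.subst σ) (A.subst τ))
  | .tm Γ t A => ∀ {Δ : Ctx} {σ τ : ℕ → Tm}, EqSubst Δ Γ σ τ →
      Derivable (.tmEq Δ (t.subst σ) (t.subst τ) (A.subst σ))
  | _ => True

/-- Each formation or typing rule has a matching congruence rule. Equality judgements can be left
out of the induction: they follow later by transitivity, once their right-hand sides are known to be
well formed. -/
theorem Derivable.respectsEqSubst {J : Judgement} (h : Derivable J) : J.RespectsEqSubst := by
  induction h
  all_goals try exact trivial
  all_goals
    simp only [Judgement.RespectsEqSubst, Ty.subst, Tm.subst, Ty.inst_subst'] at *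
    intro Δ σ τ k
    have hΔ := k.left.ctx
  case ty_ans => exact tyEq_refl (ty_ans hΔ)
  case ty_pi hA _ ihA ihB => exact tyEq_pi (hA.subst k.left) (ihA k) (ihB (k.lift hA (ihA k)))
  case ty_sigma hA _ ihA ihB =>
    exact tyEq_sigma (hA.subst k.left) (ihA k) (ihB (k.lift hA (ihA k)))
  case ty_univ => exact tyEq_refl (ty_univ hΔ)
  case ty_el ih => exact tyEq_el (ih k)
  case tm_conv hE iht _ => exact tmEq_conv (iht k) (hE.subst k.left)
  case tm_var hn _ => exact k.tmEq hn
  case tm_yes => exact tmEq_refl (tm_yes hΔ)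
  case tm_no => exact tmEq_refl (tm_no hΔ)
  case tm_lam hA hB _ ihA ihB iht =>
    have k' := k.lift hA (ihA k)
    exact tmEq_lam (hA.subst k.left) (hB.subst k'.left) (iht k')
  case tm_app hA hB _ _ ihA ihB ihf iha =>
    exact tmEq_app (hA.subst k.left) (hB.subst (k.lift hA (ihA k)).left) (ihf k) (iha k)
  case tm_pair hA hB _ _ ihA ihB iha ihb =>
    exact tmEq_pair (hA.subst k.left) (hB.subst (k.lift hA (ihA k)).left) (iha k) (ihb k)
  case tm_fst hA hB _ ihA ihB ihp =>
    exact tmEq_fst (hA.subst k.left) (hB.subst (k.lift hA (ihA k)).left) (ihp k)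
  case tm_snd hA hB _ ihA ihB ihp =>
    exact tmEq_snd (hA.subst k.left) (hB.subst (k.lift hA (ihA k)).left) (ihp k)
  case tm_ansCode => exact tmEq_refl (tm_ansCode hΔ)
  case tm_piCode ha _ iha ihb =>
    exact tmEq_piCode (ha.subst k.left) (iha k) (ihb (k.lift (ty_el ha) (tyEq_el (iha k))))
  case tm_sigmaCode ha _ iha ihb =>
    exact tmEq_sigmaCode (ha.subst k.left) (iha k) (ihb (k.lift (ty_el ha) (tyEq_el (iha k))))

/-! ### Presuppositions -/

theorem Derivable.ty_inst {Γ : Ctx} {A B : Ty} {a : Tm} (hB : Derivable (.ty (A :: Γ) B))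
    (ha : Derivable (.tm Γ a A)) : Derivable (.ty Γ (B.inst a)) :=
  hB.subst (WfSubst.single ha.ctx_context ha)

theorem Derivable.tm_inst {Γ : Ctx} {A B : Ty} {t a : Tm} (ht : Derivable (.tm (A :: Γ) t B))
    (ha : Derivable (.tm Γ a A)) : Derivable (.tm Γ (t.inst a) (B.inst a)) :=
  ht.subst (WfSubst.single ha.ctx_context ha)

theorem Derivable.tyEq_inst {Γ : Ctx} {A B : Ty} {a b : Tm} (hB : Derivable (.ty (A :: Γ) B))
    (ha : Derivable (.tm Γ a A)) (hb : Derivable (.tm Γ b A))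
    (e : Derivable (.tmEq Γ a b A)) : Derivable (.tyEq Γ (B.inst a) (B.inst b)) := by
  have hΓ := ha.ctx_context
  have k := (EqSubst.refl (WfSubst.var hΓ)).scons (A := A) (a := a) (b := b)
    (by rwa [Ty.subst_var]) (by rwa [Ty.subst_var]) (by rwa [Ty.subst_var])
  rw [← single_eq_scons, ← single_eq_scons] at k
  exact hB.respectsEqSubst k

/-- Typing the identity substitution between the two contexts makes context conversion an instance
of the substitution theorem. -/
theorem WfSubst.conv {Γ : Ctx} {A A' : Ty} (hA : Derivable (.ty Γ A'))
    (e : Derivable (.tyEq Γ A A')) : WfSubst (A' :: Γ) (A :: Γ) .var := by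
  have hA' := ctx_cons hA.ctx_context hA
  refine ⟨hA', fun hn => ?_⟩
  rw [Ty.subst_var]
  cases hn with
  | here => exact tm_conv (tm_var_zero hA') ((tyEq_symm e).tyEq_weaken hA')
  | there _ n B _ hn => exact tm_var hA' (.there _ _ _ _ hn)

theorem Derivable.ty_conv {Γ : Ctx} {A A' B : Ty} (hB : Derivable (.ty (A :: Γ) B))
    (hA : Derivable (.ty Γ A')) (e : Derivable (.tyEq Γ A A')) :
    Derivable (.ty (A' :: Γ) B) := by
  simpa [Judgement.subst, Ty.subst_var] using hB.subst (WfSubst.conv hA e)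

theorem Derivable.tm_ctx_conv {Γ : Ctx} {A A' B : Ty} {t : Tm}
    (ht : Derivable (.tm (A :: Γ) t B)) (hA : Derivable (.ty Γ A'))
    (e : Derivable (.tyEq Γ A A')) : Derivable (.tm (A' :: Γ) t B) := by
  simpa [Judgement.subst, Ty.subst_var, Tm.subst_var] using ht.subst (WfSubst.conv hA e)

/-- The well-formedness of both sides of an equality judgement. -/
def Judgement.SidesWf : Judgement → Prop
  | .tyEq Γ A B => Derivable (.ty Γ A) ∧ Derivable (.ty Γ B)
  | .tmEq Γ t s A => Derivable (.tm Γ t A) ∧ Derivable (.tm Γ s A)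
  | _ => True

/-- In the η-rule a weakened function is applied to the fresh variable; this identifies the
resulting type with the original codomain. -/
theorem Ty.rename_liftRen_succ_inst_zero (B : Ty) :
    (B.rename (liftRen Nat.succ)).inst (.var 0) = B := by
  rw [Ty.rename_eq_subst, Ty.inst, Ty.subst_subst]
  conv_rhs => rw [← Ty.subst_var B]
  congr 1; funext n; cases n <;> rfl

/-- In the congruence rules the right-hand side may naturally live over `A'` or have a type
instantiated at the other term. Context conversion and `Derivable.tyEq_inst` bring it back. -/
theorem Derivable.sidesWf {J : Judgement} (h : Derivable J) : J.SidesWf := by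
  induction h
  all_goals try exact trivial
  all_goals simp only [Judgement.SidesWf] at *
  case tyEq_refl h _ => exact ⟨h, h⟩
  case tyEq_symm ih => exact ih.symm
  case tyEq_trans ih₁ ih₂ => exact ⟨ih₁.1, ih₂.2⟩
  case tyEq_pi hA e _ _ ihE ihB => exact ⟨ty_pi hA ihB.1, ty_pi ihE.2 (ihB.2.ty_conv ihE.2 e)⟩
  case tyEq_sigma hA e _ _ ihE ihB =>
    exact ⟨ty_sigma hA ihB.1, ty_sigma ihE.2 (ihB.2.ty_conv ihE.2 e)⟩
  case tyEq_el ih => exact ⟨ty_el ih.1, ty_el ih.2⟩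
  case el_ans h _ => exact ⟨ty_el (tm_ansCode h), ty_ans h⟩
  case el_pi ha hb _ _ => exact ⟨ty_el (tm_piCode ha hb), ty_pi (ty_el ha) (ty_el hb)⟩
  case el_sigma ha hb _ _ =>
    exact ⟨ty_el (tm_sigmaCode ha hb), ty_sigma (ty_el ha) (ty_el hb)⟩
  case tmEq_refl h _ => exact ⟨h, h⟩
  case tmEq_symm ih => exact ih.symm
  case tmEq_trans ih₁ ih₂ => exact ⟨ih₁.1, ih₂.2⟩
  case tmEq_conv e iht _ => exact ⟨tm_conv iht.1 e, tm_conv iht.2 e⟩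
  case tmEq_lam hA hB _ _ _ iht => exact ⟨tm_lam hA hB iht.1, tm_lam hA hB iht.2⟩
  case tmEq_app hA hB _ ea _ _ ihf iha =>
    exact ⟨tm_app hA hB ihf.1 iha.1,
      tm_conv (tm_app hA hB ihf.2 iha.2) (tyEq_symm (hB.tyEq_inst iha.1 iha.2 ea))⟩
  case tmEq_pair hA hB ea _ _ _ iha ihb =>
    exact ⟨tm_pair hA hB iha.1 ihb.1,
      tm_pair hA hB iha.2 (tm_conv ihb.2 (hB.tyEq_inst iha.1 iha.2 ea))⟩
  case tmEq_fst hA hB _ _ _ ihp => exact ⟨tm_fst hA hB ihp.1, tm_fst hA hB ihp.2⟩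
  case tmEq_snd hA hB ep _ _ ihp =>
    exact ⟨tm_snd hA hB ihp.1, tm_conv (tm_snd hA hB ihp.2) (tyEq_symm
      (hB.tyEq_inst (tm_fst hA hB ihp.1) (tm_fst hA hB ihp.2) (tmEq_fst hA hB ep)))⟩
  case tmEq_piCode ha e _ _ ihE ihb =>
    exact ⟨tm_piCode ha ihb.1,
      tm_piCode ihE.2 (ihb.2.tm_ctx_conv (ty_el ihE.2) (tyEq_el e))⟩
  case tmEq_sigmaCode ha e _ _ ihE ihb =>
    exact ⟨tm_sigmaCode ha ihb.1,
      tm_sigmaCode ihE.2 (ihb.2.tm_ctx_conv (ty_el ihE.2) (tyEq_el e))⟩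
  case pi_beta hA hB ht ha _ _ _ _ =>
    exact ⟨tm_app hA hB (tm_lam hA hB ht) ha, ht.tm_inst ha⟩
  case pi_eta Γ f A B hA hB hf _ _ _ =>
    refine ⟨tm_lam hA hB ?_, hf⟩
    have hΓ := ctx_cons hA.ctx_context hA
    have hAw : Derivable (.ty (A :: Γ) A.weaken) := by
      rw [Ty.weaken, Ty.rename_eq_subst]
      exact hA.weaken hΓ
    have hBw : Derivable (.ty (A.weaken :: A :: Γ) (B.rename (liftRen Nat.succ))) := by
      rw [Ty.rename_eq_subst, ← liftSub_var_comp]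
      have hw : WfSubst (A :: Γ) Γ (fun n => .var n.succ) := ⟨hΓ, fun hn => by
        rw [← Ty.rename_eq_subst]; exact tm_var hΓ (.there _ _ _ _ hn)⟩
      have := hB.subst (hw.lift (hA.subst hw))
      rwa [← Ty.rename_eq_subst A] at this
    have := tm_app hAw hBw
      (hf.tm_weaken hΓ) (tm_var_zero hΓ)
    rwa [Ty.rename_liftRen_succ_inst_zero] at this
  case sigma_beta_fst hA hB ha hb _ _ _ _ =>
    exact ⟨tm_fst hA hB (tm_pair hA hB ha hb), ha⟩
  case sigma_beta_snd hA hB ha hb _ _ _ _ =>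
    have hp := tm_pair hA hB ha hb
    exact ⟨tm_conv (tm_snd hA hB hp)
      (hB.tyEq_inst (tm_fst hA hB hp) ha (sigma_beta_fst hA hB ha hb)), hb⟩
  case sigma_eta hA hB hp _ _ _ =>
    exact ⟨tm_pair hA hB (tm_fst hA hB hp) (tm_snd hA hB hp), hp⟩

theorem Derivable.tm_left {Γ : Ctx} {t s : Tm} {A : Ty} (h : Derivable (.tmEq Γ t s A)) :
    Derivable (.tm Γ t A) := h.sidesWf.1

theorem Derivable.tm_right {Γ : Ctx} {t s : Tm} {A : Ty} (h : Derivable (.tmEq Γ t s A)) :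
    Derivable (.tm Γ s A) := h.sidesWf.2

theorem Derivable.tyEq_subst {Γ Δ : Ctx} {A B : Ty} {σ τ : ℕ → Tm}
    (h : Derivable (.tyEq Γ A B)) (k : EqSubst Δ Γ σ τ) :
    Derivable (.tyEq Δ (A.subst σ) (B.subst τ)) :=
  tyEq_trans (h.subst k.left) (h.sidesWf.2.respectsEqSubst k)

theorem Derivable.tmEq_subst {Γ Δ : Ctx} {t s : Tm} {A : Ty} {σ τ : ℕ → Tm}
    (h : Derivable (.tmEq Γ t s A)) (k : EqSubst Δ Γ σ τ) :
    Derivable (.tmEq Δ (t.subst σ) (s.subst τ) (A.subst σ)) :=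
  tmEq_trans (h.subst k.left) (h.sidesWf.2.respectsEqSubst k)

theorem Derivable.ty_subst {Γ Δ : Ctx} {A : Ty} {σ τ : ℕ → Tm}
    (h : Derivable (.ty Γ A)) (k : EqSubst Δ Γ σ τ) :
    Derivable (.tyEq Δ (A.subst σ) (A.subst τ)) :=
  h.respectsEqSubst k

/-! ### Weak head reduction -/

/-- One step of weak head reduction of terms. -/
inductive Tm.Step : Tm → Tm → Prop
  | app {f f' : Tm} (a : Tm) : Step f f' → Step (.app f a) (.app f' a)
  | fst {p p' : Tm} : Step p p' → Step (.fst p) (.fst p')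
  | snd {p p' : Tm} : Step p p' → Step (.snd p) (.snd p')
  | beta (t a : Tm) : Step (.app (.lam t) a) (t.inst a)
  | fst_pair (a b : Tm) : Step (.fst (.pair a b)) a
  | snd_pair (a b : Tm) : Step (.snd (.pair a b)) b

/-- Abstractions and pairs do not step, so a contraction never competes with a step in head
position. -/
theorem Tm.Step.deterministic {t s r : Tm} (h : t.Step s) (h' : t.Step r) : s = r := by
  induction h generalizing r with
  | app a h ih =>
    cases h' with
    | app _ h' => rw [ih h']
    | beta => cases h
  | fst h ih =>
    cases h' with
    | fst h' => rw [ih h']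
    | fst_pair => cases h
  | snd h ih =>
    cases h' with
    | snd h' => rw [ih h']
    | snd_pair => cases h
  | beta =>
    cases h' with
    | app _ h' => cases h'
    | beta => rfl
  | fst_pair =>
    cases h' with
    | fst h' => cases h'
    | fst_pair => rfl
  | snd_pair =>
    cases h' with
    | snd h' => cases h'
    | snd_pair => rfl

/-- One step of weak head reduction of types. -/
inductive Ty.Step : Ty → Ty → Prop
  | el {a a' : Tm} : a.Step a' → Step (.el a) (.el a')
  | ans : Step (.el .ansCode) .ans
  | pi (a b : Tm) : Step (.el (.piCode a b)) (.pi (.el a) (.el b))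
  | sigma (a b : Tm) : Step (.el (.sigmaCode a b)) (.sigma (.el a) (.el b))

theorem Ty.Step.deterministic {A B C : Ty} (h : A.Step B) (h' : A.Step C) : B = C := by
  cases h with
  | el h =>
    cases h' with
    | el h' => rw [h.deterministic h']
    | _ => cases h
  | _ =>
    cases h' with
    | el h' => cases h'
    | _ => rfl

/-! ### Computability relations -/

/-- Binary relations on raw terms. -/
abbrev TmRel : Type := Tm → Tm → Prop

/-- Computability at the answer type. -/
def AnsRel : TmRel := fun t s =>
  Derivable (.tmEq [] t s .ans) ∧
    (Derivable (.tmEq [] t .yes .ans) ∨ Derivable (.tmEq [] t .no .ans))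

/-- Computability at a product, for a relation on the domain and a family of relations on the
fibres. -/
def PiRel (F : Ty) (RF : TmRel) (RG : Tm → TmRel) : TmRel := fun f g =>
  ∀ a b, Derivable (.tmEq [] a b F) → RF a b → RG a (.app f a) (.app g b)

/-- Computability at a sum. -/
def SigmaRel (F : Ty) (RF : TmRel) (RG : Tm → TmRel) : TmRel := fun p q =>
  Derivable (.tmEq [] (.fst p) (.fst q) F) ∧ RF (.fst p) (.fst q) ∧
    RG (.fst p) (.snd p) (.snd q)

/-- `Interp U A R`: the closed type `A` is computable, with computability relation `R` on its
elements. The possible computability relations of the universe are those in `U`. -/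
inductive Interp (U : Set TmRel) : Ty → TmRel → Prop
  | ans : Interp U .ans AnsRel
  | univ {R : TmRel} : R ∈ U → Interp U .univ R
  | pi {F G : Ty} {RF : TmRel} {RG : Tm → TmRel} : Interp U F RF →
      (∀ a, Derivable (.tm [] a F) → RF a a → Interp U (G.inst a) (RG a)) →
      (∀ a b, Derivable (.tmEq [] a b F) → RF a b → RG a = RG b) →
      Interp U (.pi F G) (PiRel F RF RG)
  | sigma {F G : Ty} {RF : TmRel} {RG : Tm → TmRel} : Interp U F RF →
      (∀ a, Derivable (.tm [] a F) → RF a a → Interp U (G.inst a) (RG a)) →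
      (∀ a b, Derivable (.tmEq [] a b F) → RF a b → RG a = RG b) →
      Interp U (.sigma F G) (SigmaRel F RF RG)
  | step {A B : Ty} {R : TmRel} : A.Step B → Derivable (.tyEq [] A B) → Interp U B R →
      Interp U A R

theorem Interp.mono {U V : Set TmRel} (hUV : U ⊆ V) {A : Ty} {R : TmRel} (h : Interp U A R) :
    Interp V A R := by
  induction h with
  | ans => exact .ans
  | univ h => exact .univ (hUV h)
  | pi _ _ hc ihF ihG => exact .pi ihF ihG hc
  | sigma _ _ hc ihF ihG => exact .sigma ihF ihG hc
  | step h e _ ih => exact .step h e ih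

/-- Computability of codes: the decoded types are computable without reference to the universe,
with the same computability relation. -/
def UnivRel : TmRel := fun a b => ∃ R, Interp ∅ (.el a) R ∧ Interp ∅ (.el b) R

/-! ### Partial equivalence and uniqueness of the computability relations -/

/-- A relation is a partial equivalence relation. -/
structure IsPer (R : TmRel) : Prop where
  symm {t s : Tm} : R t s → R s t
  trans {t s r : Tm} : R t s → R s r → R t r

theorem IsPer.left {R : TmRel} (h : IsPer R) {t s : Tm} (hts : R t s) : R t t :=
  h.trans hts (h.symm hts)

theorem IsPer.right {R : TmRel} (h : IsPer R) {t s : Tm} (hts : R t s) : R s s :=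
  h.trans (h.symm hts) hts

theorem isPer_ansRel : IsPer AnsRel where
  symm := fun ⟨h, h'⟩ => ⟨tmEq_symm h, h'.imp (tmEq_trans (tmEq_symm h))
    (tmEq_trans (tmEq_symm h))⟩
  trans := fun ⟨h, h'⟩ ⟨k, _⟩ => ⟨tmEq_trans h k, h'⟩

theorem isPer_piRel {F : Ty} {RF : TmRel} {RG : Tm → TmRel} (hF : IsPer RF)
    (hG : ∀ a, Derivable (.tm [] a F) → RF a a → IsPer (RG a))
    (hc : ∀ a b, Derivable (.tmEq [] a b F) → RF a b → RG a = RG b) :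
    IsPer (PiRel F RF RG) where
  symm := by
    intro f g h a b e hab
    have ha := hG a e.tm_left (hF.left hab)
    -- The hypothesis at the swapped arguments lives in the fibre over `b`, while the goal is over
    -- `a`.
    rw [hc a b e hab] at ha ⊢
    exact ha.symm (h b a (tmEq_symm e) (hF.symm hab))
  trans := by
    intro f g k h h' a b e hab
    exact (hG a e.tm_left (hF.left hab)).trans
      (h a a (tmEq_refl e.tm_left) (hF.left hab)) (h' a b e hab)

theorem isPer_sigmaRel {F : Ty} {RF : TmRel} {RG : Tm → TmRel} (hF : IsPer RF)
    (hG : ∀ a, Derivable (.tm [] a F) → RF a a → IsPer (RG a))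
    (hc : ∀ a b, Derivable (.tmEq [] a b F) → RF a b → RG a = RG b) :
    IsPer (SigmaRel F RF RG) where
  symm := by
    rintro p q ⟨e, h₁, h₂⟩
    refine ⟨tmEq_symm e, hF.symm h₁, ?_⟩
    rw [← hc _ _ e h₁]
    exact (hG _ e.tm_left (hF.left h₁)).symm h₂
  trans := by
    rintro p q r ⟨e, h₁, h₂⟩ ⟨e', h₁', h₂'⟩
    refine ⟨tmEq_trans e e', hF.trans h₁ h₁', ?_⟩
    rw [← hc _ _ e h₁] at h₂'
    exact (hG _ e.tm_left (hF.left h₁)).trans h₂ h₂'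

/-- The domain type enters only through judgemental equality of arguments, and the family only
through its values at computable arguments. -/
theorem piRel_congr {F F' : Ty} {RF : TmRel} {RG RG' : Tm → TmRel} (hF : IsPer RF)
    (e : Derivable (.tyEq [] F F'))
    (h : ∀ a, Derivable (.tm [] a F) → RF a a → RG a = RG' a) :
    PiRel F RF RG = PiRel F' RF RG' := by
  funext f g
  refine propext ⟨fun k a b hab r => ?_, fun k a b hab r => ?_⟩
  · have hab' := tmEq_conv hab (tyEq_symm e)
    rw [← h a hab'.tm_left (hF.left r)]
    exact k a b hab' r
  · rw [h a hab.tm_left (hF.left r)]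
    exact k a b (tmEq_conv hab e) r

theorem sigmaRel_congr {F F' : Ty} {RF : TmRel} {RG RG' : Tm → TmRel} (hF : IsPer RF)
    (e : Derivable (.tyEq [] F F'))
    (h : ∀ a, Derivable (.tm [] a F) → RF a a → RG a = RG' a) :
    SigmaRel F RF RG = SigmaRel F' RF RG' := by
  funext p q
  refine propext ⟨fun ⟨k, r, s⟩ => ⟨tmEq_conv k e, r, ?_⟩, fun ⟨k, r, s⟩ =>
    ⟨tmEq_conv k (tyEq_symm e), r, ?_⟩⟩
  · rwa [← h _ k.tm_left (hF.left r)]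
  · rwa [h _ (tmEq_conv k (tyEq_symm e)).tm_left (hF.left r)]

/-- A type has at most one computability relation, which is a partial equivalence relation,
provided this holds for the universe. -/
theorem Interp.isPer_and_unique {U : Set TmRel} (hU : ∀ R ∈ U, IsPer R) (hU' : U.Subsingleton)
    {A : Ty} {R : TmRel} (h : Interp U A R) : IsPer R ∧ ∀ R', Interp U A R' → R = R' := by
  induction h with
  | ans =>
    refine ⟨isPer_ansRel, fun R' h' => ?_⟩
    cases h' with
    | ans => rfl
    | step h => cases h
  | univ h =>
    refine ⟨hU _ h, fun R' h' => ?_⟩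
    cases h' with
    | univ h' => exact hU' h h'
    | step h => cases h
  | @pi F G RF RG hF hG hc ihF ihG =>
    refine ⟨isPer_piRel ihF.1 (fun a ha r => (ihG a ha r).1) hc, fun R' h' => ?_⟩
    cases h' with
    | pi hF' hG' hc' =>
      obtain rfl := ihF.2 _ hF'
      -- The two families may differ away from computable arguments, but `PiRel` never looks there.
      funext f g
      refine propext (forall₄_congr fun a b e r => ?_)
      rw [(ihG a e.tm_left (ihF.1.left r)).2 _ (hG' a e.tm_left (ihF.1.left r))]
    | step h => cases h
  | @sigma F G RF RG hF hG hc ihF ihG =>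
    refine ⟨isPer_sigmaRel ihF.1 (fun a ha r => (ihG a ha r).1) hc, fun R' h' => ?_⟩
    cases h' with
    | sigma hF' hG' hc' =>
      obtain rfl := ihF.2 _ hF'
      funext p q
      refine propext (and_congr_right fun e => and_congr_right fun r => ?_)
      rw [(ihG _ e.tm_left (ihF.1.left r)).2 _ (hG' _ e.tm_left (ihF.1.left r))]
    | step h => cases h
  | step h _ _ ih =>
    refine ⟨ih.1, fun R' h' => ?_⟩
    cases h' with
    | step k _ h' => obtain rfl := h.deterministic k; exact ih.2 _ h'
    | _ => cases h

/-- Transitivity is uniqueness of interpretation at level `∅`, where the assumptions about universe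
relations are vacuous; the full level can then rely on it. -/
theorem isPer_univRel : IsPer UnivRel where
  symm := fun ⟨R, h, k⟩ => ⟨R, k, h⟩
  trans := by
    rintro a b c ⟨R, h, k⟩ ⟨R', h', k'⟩
    obtain rfl := (k.isPer_and_unique (by simp) (by simp)).2 _ h'
    exact ⟨R, h, k'⟩

theorem Interp.isPer {A : Ty} {R : TmRel} (h : Interp {UnivRel} A R) : IsPer R :=
  (h.isPer_and_unique (by simpa using isPer_univRel) (by simp)).1

theorem Interp.unique {A : Ty} {R R' : TmRel} (h : Interp {UnivRel} A R)
    (h' : Interp {UnivRel} A R') : R = R' :=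
  (h.isPer_and_unique (by simpa using isPer_univRel) (by simp)).2 R' h'

/-- Type formation has no conversion rule, so inversion of the derivation suffices. -/
theorem Derivable.ty_pi_inv {Γ : Ctx} {A B : Ty} (h : Derivable (.ty Γ (.pi A B))) :
    Derivable (.ty Γ A) ∧ Derivable (.ty (A :: Γ) B) := by
  cases h with
  | ty_pi hA hB => exact ⟨hA, hB⟩

theorem Derivable.ty_sigma_inv {Γ : Ctx} {A B : Ty} (h : Derivable (.ty Γ (.sigma A B))) :
    Derivable (.ty Γ A) ∧ Derivable (.ty (A :: Γ) B) := by
  cases h with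
  | ty_sigma hA hB => exact ⟨hA, hB⟩

/-- Computability relations are closed under typed weak head expansion. -/
theorem Interp.expand {A : Ty} {R : TmRel} (h : Interp {UnivRel} A R)
    (hA : Derivable (.ty [] A)) {t s r : Tm} (hts : t.Step s)
    (e : Derivable (.tmEq [] t s A)) (hsr : R s r) : R t r := by
  induction h generalizing t s r with
  | ans => exact ⟨tmEq_trans e hsr.1, hsr.2.imp (tmEq_trans e) (tmEq_trans e)⟩
  | univ h =>
    obtain rfl := h
    obtain ⟨R, h₁, h₂⟩ := hsr
    -- A step of a code is a step of the decoded type, which keeps its relation.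
    exact ⟨R, .step (.el hts) (tyEq_el e) h₁, h₂⟩
  | @pi F G RF RG hF hG hc ihF ihG =>
    obtain ⟨hF', hG'⟩ := hA.ty_pi_inv
    intro a b hab rab
    have ha := hab.tm_left
    exact ihG a ha (hF.isPer.left rab) (hG'.ty_inst ha) (.app a hts)
      (tmEq_app hF' hG' e (tmEq_refl ha)) (hsr a b hab rab)
  | @sigma F G RF RG hF hG hc ihF ihG =>
    obtain ⟨hF', hG'⟩ := hA.ty_sigma_inv
    obtain ⟨e₁, h₁, h₂⟩ := hsr
    have e₂ := tmEq_fst hF' hG' e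
    have h₁' := ihF hF' (.fst hts) e₂ h₁
    refine ⟨tmEq_trans e₂ e₁, h₁', ?_⟩
    -- The first projections of `t` and `s` are both related to that of `r`, so the fibre over the
    -- former has the relation of the fibre where `h₂` lives.
    rw [hc _ _ (tmEq_trans e₂ e₁) h₁', ← hc _ _ e₁ h₁]
    exact ihG _ e₁.tm_left (hF.isPer.left h₁) (hG'.ty_inst e₁.tm_left) (.snd hts)
      (tmEq_conv (tmEq_snd hF' hG' e) (hG'.tyEq_inst e₂.tm_left e₂.tm_right e₂)) h₂
  | step _ e' _ ih => exact ih e'.sidesWf.2 hts (tmEq_conv e e') hsr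

/-- The computability relation of a closed type. -/
def Ty.rel (A : Ty) : TmRel := fun t s => ∃ R, Interp {UnivRel} A R ∧ R t s

theorem Interp.rel_eq {A : Ty} {R : TmRel} (h : Interp {UnivRel} A R) : A.rel = R := by
  funext t s
  exact propext ⟨fun ⟨R', h', k⟩ => by rwa [h.unique h'], fun k => ⟨R, h, k⟩⟩

/-- Computability of `A` is not required: a type without interpretation has the empty relation. -/
theorem Ty.isPer_rel (A : Ty) : IsPer A.rel where
  symm := fun ⟨R, h, k⟩ => ⟨R, h, h.isPer.symm k⟩
  trans := by
    rintro t s r ⟨R, h, k⟩ ⟨R', h', k'⟩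
    obtain rfl := h.unique h'
    exact ⟨R, h, h.isPer.trans k k'⟩

theorem Ty.rel_expand {A : Ty} (hA : Derivable (.ty [] A)) {t s r : Tm} (hts : t.Step s)
    (e : Derivable (.tmEq [] t s A)) (hsr : A.rel s r) : A.rel t r := by
  obtain ⟨R, h, k⟩ := hsr
  exact ⟨R, h, h.expand hA hts e k⟩

/-! ### Computable equality of types and families -/

/-- Computable equality of closed types. -/
structure CompTyEq (U : Set TmRel) (A B : Ty) : Prop where
  left : Interp U A A.rel
  right : Interp U B B.rel
  rel_eq : A.rel = B.rel

theorem CompTyEq.symm {U : Set TmRel} {A B : Ty} (h : CompTyEq U A B) : CompTyEq U B A :=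
  ⟨h.right, h.left, h.rel_eq.symm⟩

theorem CompTyEq.trans {U : Set TmRel} {A B C : Ty} (h : CompTyEq U A B)
    (k : CompTyEq U B C) : CompTyEq U A C :=
  ⟨h.left, k.right, h.rel_eq.trans k.rel_eq⟩

theorem CompTyEq.mono {U V : Set TmRel} (hUV : U ⊆ V) {A B : Ty} (h : CompTyEq U A B) :
    CompTyEq V A B :=
  ⟨h.left.mono hUV, h.right.mono hUV, h.rel_eq⟩

/-- The relation `A.rel` is defined at the full level; by monotonicity and uniqueness it agrees with
any relation found at level `U`. -/
theorem Interp.compTyEq {U : Set TmRel} (hU : U ⊆ {UnivRel}) {A B : Ty} {R : TmRel}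
    (hA : Interp U A R) (hB : Interp U B R) : CompTyEq U A B := by
  have h := (hA.mono hU).rel_eq
  have k := (hB.mono hU).rel_eq
  exact ⟨by rwa [h], by rwa [k], h.trans k.symm⟩

theorem compTyEq_ans {U : Set TmRel} (hU : U ⊆ {UnivRel}) : CompTyEq U .ans .ans :=
  Interp.ans.compTyEq hU .ans

theorem rel_univ : Ty.univ.rel = UnivRel := (Interp.univ (Set.mem_singleton UnivRel)).rel_eq

theorem compTyEq_univ : CompTyEq {UnivRel} .univ .univ :=
  (Interp.univ (Set.mem_singleton UnivRel)).compTyEq subset_rfl (.univ (Set.mem_singleton UnivRel))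

theorem univRel_iff {a b : Tm} : UnivRel a b ↔ CompTyEq ∅ (.el a) (.el b) :=
  ⟨fun ⟨_, h, k⟩ => h.compTyEq (by simp) k, fun h => ⟨_, h.left, h.rel_eq ▸ h.right⟩⟩

/-- Computable equality of families of types over a computable type. -/
def CompFamEq (U : Set TmRel) (F G G' : Ty) : Prop :=
  ∀ a b, Derivable (.tmEq [] a b F) → F.rel a b → CompTyEq U (G.inst a) (G'.inst b)

theorem CompFamEq.left {U : Set TmRel} {F G G' : Ty} (h : CompFamEq U F G G') :
    CompFamEq U F G G := fun a b e r =>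
  (h a b e r).trans (h b b (tmEq_refl e.tm_right) (F.isPer_rel.right r)).symm

theorem CompFamEq.right {U : Set TmRel} {F G G' : Ty} (h : CompFamEq U F G G') :
    CompFamEq U F G' G' := fun a b e r =>
  (h a a (tmEq_refl e.tm_left) (F.isPer_rel.left r)).symm.trans (h a b e r)

theorem CompFamEq.conv {U : Set TmRel} {F F' G G' : Ty} (h : CompFamEq U F G G')
    (e : Derivable (.tyEq [] F F')) (hF : F.rel = F'.rel) : CompFamEq U F' G G' :=
  fun a b e' r => h a b (tmEq_conv e' (tyEq_symm e)) (hF ▸ r)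

theorem Interp.pi_rel {U : Set TmRel} {F G : Ty} (hF : Interp U F F.rel)
    (hG : CompFamEq U F G G) :
    Interp U (.pi F G) (PiRel F F.rel fun a => (G.inst a).rel) :=
  .pi hF (fun a ha r => (hG a a (tmEq_refl ha) r).left) fun a b e r => (hG a b e r).rel_eq

theorem Interp.sigma_rel {U : Set TmRel} {F G : Ty} (hF : Interp U F F.rel)
    (hG : CompFamEq U F G G) :
    Interp U (.sigma F G) (SigmaRel F F.rel fun a => (G.inst a).rel) :=
  .sigma hF (fun a ha r => (hG a a (tmEq_refl ha) r).left) fun a b e r => (hG a b e r).rel_eq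

theorem compTyEq_pi {U : Set TmRel} (hU : U ⊆ {UnivRel}) {F F' G G' : Ty}
    (e : Derivable (.tyEq [] F F')) (hF : CompTyEq U F F') (hG : CompFamEq U F G G') :
    CompTyEq U (.pi F G) (.pi F' G') := by
  refine (Interp.pi_rel hF.left hG.left).compTyEq hU ?_
  rw [piRel_congr F.isPer_rel e fun a ha r => (hG a a (tmEq_refl ha) r).rel_eq, hF.rel_eq]
  exact Interp.pi_rel hF.right (hG.right.conv e hF.rel_eq)

theorem compTyEq_sigma {U : Set TmRel} (hU : U ⊆ {UnivRel}) {F F' G G' : Ty}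
    (e : Derivable (.tyEq [] F F')) (hF : CompTyEq U F F') (hG : CompFamEq U F G G') :
    CompTyEq U (.sigma F G) (.sigma F' G') := by
  refine (Interp.sigma_rel hF.left hG.left).compTyEq hU ?_
  rw [sigmaRel_congr F.isPer_rel e fun a ha r => (hG a a (tmEq_refl ha) r).rel_eq, hF.rel_eq]
  exact Interp.sigma_rel hF.right (hG.right.conv e hF.rel_eq)

theorem rel_pi {F G : Ty} (hF : CompTyEq {UnivRel} F F) (hG : CompFamEq {UnivRel} F G G) :
    (Ty.pi F G).rel = PiRel F F.rel fun a => (G.inst a).rel :=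
  (Interp.pi_rel hF.left hG).rel_eq

theorem rel_sigma {F G : Ty} (hF : CompTyEq {UnivRel} F F)
    (hG : CompFamEq {UnivRel} F G G) :
    (Ty.sigma F G).rel = SigmaRel F F.rel fun a => (G.inst a).rel :=
  (Interp.sigma_rel hF.left hG).rel_eq

theorem CompTyEq.of_step {U : Set TmRel} (hU : U ⊆ {UnivRel}) {A B : Ty} (h : A.Step B)
    (e : Derivable (.tyEq [] A B)) (hB : Interp U B B.rel) : CompTyEq U A B :=
  (Interp.step h e hB).compTyEq hU hB

/-! ### Validity of judgements -/

/-- Expansion on the right is expansion on the left conjugated by symmetry. Two types occur because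
related abstractions, applied to related arguments, reduce in different instances of the codomain.
-/
theorem Ty.rel_expand₂ {A B : Ty} (hA : Derivable (.ty [] A)) (hB : Derivable (.ty [] B))
    (h : A.rel = B.rel) {t t' s s' : Tm} (ht : t.Step t')
    (et : Derivable (.tmEq [] t t' A)) (hs : s.Step s') (es : Derivable (.tmEq [] s s' B))
    (r : A.rel t' s') : A.rel t s := by
  refine rel_expand hA ht et (A.isPer_rel.symm ?_)
  rw [h] at r ⊢
  exact rel_expand hB hs es (B.isPer_rel.symm r)

/-- `σ` and `τ` are computably equal closing substitutions for `Γ`. -/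
structure CompSubst (Γ : Ctx) (σ τ : ℕ → Tm) : Prop where
  eq : EqSubst [] Γ σ τ
  tyEq {n : ℕ} {A : Ty} : Lookup Γ n A → CompTyEq {UnivRel} (A.subst σ) (A.subst τ)
  rel {n : ℕ} {A : Ty} : Lookup Γ n A → (A.subst σ).rel (σ n) (τ n)

theorem CompSubst.left {Γ : Ctx} {σ τ : ℕ → Tm} (k : CompSubst Γ σ τ) : CompSubst Γ σ σ :=
  ⟨.refl k.eq.left, fun hn => (k.tyEq hn).trans (k.tyEq hn).symm,
    fun hn => (Ty.isPer_rel _).left (k.rel hn)⟩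

theorem CompSubst.right {Γ : Ctx} {σ τ : ℕ → Tm} (k : CompSubst Γ σ τ) : CompSubst Γ τ τ :=
  ⟨.refl k.eq.right, fun hn => (k.tyEq hn).symm.trans (k.tyEq hn),
    fun hn => (k.tyEq hn).rel_eq ▸ (Ty.isPer_rel _).right (k.rel hn)⟩

/-- Semantic validity of an equality of types. -/
def ValidTyEq (Γ : Ctx) (A B : Ty) : Prop :=
  ∀ ⦃σ τ : ℕ → Tm⦄, CompSubst Γ σ τ → CompTyEq {UnivRel} (A.subst σ) (B.subst τ)

/-- Semantic validity of an equality of terms. -/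
def ValidTmEq (Γ : Ctx) (t s : Tm) (A : Ty) : Prop :=
  ValidTyEq Γ A A ∧ ∀ ⦃σ τ : ℕ → Tm⦄, CompSubst Γ σ τ →
    (A.subst σ).rel (t.subst σ) (s.subst τ)

/-- Semantic validity of a judgement. -/
def Judgement.Valid : Judgement → Prop
  | .ctx _ => True
  | .ty Γ A => ValidTyEq Γ A A
  | .tyEq Γ A B => ValidTyEq Γ A B
  | .tm Γ t A => ValidTmEq Γ t t A
  | .tmEq Γ t s A => ValidTmEq Γ t s A

section
variable {Γ : Ctx} {A A' B B' C : Ty} {t t' s r a a' b b' f f' p p' : Tm} {σ τ : ℕ → Tm}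

/-- The diagonal pairs `k.left` and `k.right` supply the exchange of sides, so the substitutions
themselves need not be swapped. -/
theorem ValidTyEq.symm (h : ValidTyEq Γ A B) : ValidTyEq Γ B A := fun _ _ k =>
  (h k.left).symm.trans ((h k).trans (h k.right).symm |>.trans (h k.right)
    |>.trans (h k.right).symm)

theorem ValidTyEq.trans (h : ValidTyEq Γ A B) (h' : ValidTyEq Γ B C) : ValidTyEq Γ A C :=
  fun _ _ k => (h k.left).trans (h' k)

theorem ValidTyEq.left (h : ValidTyEq Γ A B) : ValidTyEq Γ A A := h.trans h.symm

theorem ValidTmEq.symm (h : ValidTmEq Γ t s A) : ValidTmEq Γ s t A := by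
  refine ⟨h.1, fun σ τ k => ?_⟩
  have per := (A.subst σ).isPer_rel
  have hτ := h.2 k.right
  rw [← (h.1 k).rel_eq] at hτ
  exact per.trans (per.symm (h.2 k.left)) (per.trans (h.2 k) (per.symm hτ))

theorem ValidTmEq.trans (h : ValidTmEq Γ t s A) (h' : ValidTmEq Γ s r A) :
    ValidTmEq Γ t r A :=
  ⟨h.1, fun σ _ k => (A.subst σ).isPer_rel.trans (h.2 k.left) (h'.2 k)⟩

theorem ValidTmEq.left (h : ValidTmEq Γ t s A) : ValidTmEq Γ t t A := h.trans h.symm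

theorem ValidTmEq.right (h : ValidTmEq Γ t s A) : ValidTmEq Γ s s A := h.symm.trans h

theorem ValidTmEq.conv (h : ValidTmEq Γ t s A) (e : ValidTyEq Γ A B) : ValidTmEq Γ t s B :=
  ⟨e.symm.trans e, fun _ _ k => (e k.left).rel_eq ▸ h.2 k⟩

theorem CompSubst.scons (k : CompSubst Γ σ τ) (hA : Derivable (.ty Γ A))
    (vA : ValidTyEq Γ A A) (e : Derivable (.tmEq [] a b (A.subst σ)))
    (r : (A.subst σ).rel a b) : CompSubst (A :: Γ) (scons a σ) (scons b τ) := by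
  refine ⟨k.eq.scons e.tm_left (tm_conv e.tm_right (hA.ty_subst k.eq)) e, fun hn => ?_,
    fun hn => ?_⟩
  · cases hn with
    | here => simpa only [Ty.weaken_subst_scons] using vA k
    | there _ n B _ hn => simpa only [Ty.weaken_subst_scons] using k.tyEq hn
  · cases hn with
    | here => rw [Ty.weaken_subst_scons]; exact r
    | there _ n B _ hn => rw [Ty.weaken_subst_scons]; exact k.rel hn

theorem CompSubst.scons_subst (k : CompSubst Γ σ τ) (hA : Derivable (.ty Γ A))
    (e : Derivable (.tmEq Γ a b A)) (v : ValidTmEq Γ a b A) :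
    CompSubst (A :: Γ) (MLTT.scons (a.subst σ) σ) (MLTT.scons (b.subst τ) τ) :=
  k.scons hA v.1 (e.tmEq_subst k.eq) (v.2 k)

theorem ValidTyEq.inst (hA : Derivable (.ty Γ A)) (vB : ValidTyEq (A :: Γ) B B')
    (e : Derivable (.tmEq Γ a b A)) (v : ValidTmEq Γ a b A) :
    ValidTyEq Γ (B.inst a) (B'.inst b) := fun σ τ k => by
  rw [Ty.inst_subst, Ty.inst_subst]
  exact vB (k.scons_subst hA e v)

theorem ValidTmEq.inst (hA : Derivable (.ty Γ A)) (vt : ValidTmEq (A :: Γ) t t' B)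
    (e : Derivable (.tmEq Γ a b A)) (v : ValidTmEq Γ a b A) :
    ValidTmEq Γ (t.inst a) (t'.inst b) (B.inst a) := by
  refine ⟨vt.1.inst hA (tmEq_refl e.tm_left) v.left, fun σ τ k => ?_⟩
  rw [Ty.inst_subst, Tm.inst_subst, Tm.inst_subst]
  exact vt.2 (k.scons_subst hA e v)

/-- Turns validity over an extended context into the family condition that products and sums
require. -/
theorem ValidTyEq.fam (k : CompSubst Γ σ τ) (hA : Derivable (.ty Γ A))
    (vA : ValidTyEq Γ A A) (vB : ValidTyEq (A :: Γ) B B') :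
    CompFamEq {UnivRel} (A.subst σ) (B.subst (liftSub σ)) (B'.subst (liftSub τ)) := by
  intro a b e r
  rw [Ty.subst_liftSub_inst, Ty.subst_liftSub_inst]
  exact vB (k.scons hA vA e r)

theorem ValidTyEq.ans : ValidTyEq Γ .ans .ans := fun _ _ _ => compTyEq_ans subset_rfl

theorem ValidTyEq.univ : ValidTyEq Γ .univ .univ := fun _ _ _ => compTyEq_univ

theorem ValidTyEq.pi (hA : Derivable (.ty Γ A)) (eA : Derivable (.tyEq Γ A A'))
    (vA : ValidTyEq Γ A A') (vB : ValidTyEq (A :: Γ) B B') :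
    ValidTyEq Γ (.pi A B) (.pi A' B') := fun _ _ k =>
  compTyEq_pi subset_rfl (eA.tyEq_subst k.eq) (vA k) (vA.left.fam k hA vB)

theorem ValidTyEq.sigma (hA : Derivable (.ty Γ A)) (eA : Derivable (.tyEq Γ A A'))
    (vA : ValidTyEq Γ A A') (vB : ValidTyEq (A :: Γ) B B') :
    ValidTyEq Γ (.sigma A B) (.sigma A' B') := fun _ _ k =>
  compTyEq_sigma subset_rfl (eA.tyEq_subst k.eq) (vA k) (vA.left.fam k hA vB)

theorem rel_pi_subst (k : CompSubst Γ σ τ) (hA : Derivable (.ty Γ A))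
    (vA : ValidTyEq Γ A A) (vB : ValidTyEq (A :: Γ) B B) :
    ((Ty.pi A B).subst σ).rel = PiRel (A.subst σ) (A.subst σ).rel
      fun a => ((B.subst (liftSub σ)).inst a).rel :=
  rel_pi (vA k.left) (vA.fam k.left hA vB)

theorem rel_sigma_subst (k : CompSubst Γ σ τ) (hA : Derivable (.ty Γ A))
    (vA : ValidTyEq Γ A A) (vB : ValidTyEq (A :: Γ) B B) :
    ((Ty.sigma A B).subst σ).rel = SigmaRel (A.subst σ) (A.subst σ).rel
      fun a => ((B.subst (liftSub σ)).inst a).rel :=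
  rel_sigma (vA k.left) (vA.fam k.left hA vB)

/-! ### Validity of the rules for terms -/

/-- Only the left side is expanded, starting from the validity of `s` against itself. This handles
every β-rule. -/
theorem ValidTmEq.of_step (h : ∀ σ, (t.subst σ).Step (s.subst σ))
    (e : Derivable (.tmEq Γ t s A)) (hA : Derivable (.ty Γ A)) (v : ValidTmEq Γ s s A) :
    ValidTmEq Γ t s A :=
  ⟨v.1, fun σ _ k => Ty.rel_expand (hA.subst k.eq.left) (h σ) (e.subst k.eq.left) (v.2 k)⟩

/-- Computability of the types in the context is part of `CompSubst`, which is why contexts need no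
validity condition of their own. -/
theorem ValidTmEq.var {n : ℕ} (vA : Lookup Γ n A) : ValidTmEq Γ (.var n) (.var n) A :=
  ⟨fun _ _ k => k.tyEq vA, fun _ _ k => k.rel vA⟩

theorem rel_ans : Ty.ans.rel = AnsRel := Interp.ans.rel_eq

theorem ValidTmEq.yes : ValidTmEq Γ .yes .yes .ans :=
  ⟨.ans, fun _ _ _ => by
    have h := tmEq_refl (tm_yes ctx_nil)
    change Ty.ans.rel _ _
    rw [rel_ans]
    exact ⟨h, .inl h⟩⟩

theorem ValidTmEq.no : ValidTmEq Γ .no .no .ans :=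
  ⟨.ans, fun _ _ _ => by
    have h := tmEq_refl (tm_no ctx_nil)
    change Ty.ans.rel _ _
    rw [rel_ans]
    exact ⟨h, .inr h⟩⟩

theorem ValidTmEq.lam (hA : Derivable (.ty Γ A)) (hB : Derivable (.ty (A :: Γ) B))
    (vA : ValidTyEq Γ A A) (e : Derivable (.tmEq (A :: Γ) t t' B))
    (v : ValidTmEq (A :: Γ) t t' B) : ValidTmEq Γ (.lam t) (.lam t') (.pi A B) := by
  refine ⟨.pi hA (tyEq_refl hA) vA v.1, fun σ τ k => ?_⟩
  rw [rel_pi_subst k hA vA v.1]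
  intro a b eab r
  have hl := k.eq.left.lift (hA.subst k.eq.left)
  have hr := k.eq.right.lift (hA.subst k.eq.right)
  have ha := eab.tm_left
  have hb := tm_conv eab.tm_right (hA.ty_subst k.eq)
  have hBl : Derivable (.ty _ (B.subst (liftSub σ))) := hB.subst hl
  have hBr : Derivable (.ty _ (B.subst (liftSub τ))) := hB.subst hr
  refine Ty.rel_expand₂ (hBl.ty_inst ha) (hBr.ty_inst hb) (vA.fam k hA v.1 a b eab r).rel_eq
    (.beta _ _) (pi_beta (hA.subst k.eq.left) hBl (e.tm_left.subst hl) ha)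
    (.beta _ _) (pi_beta (hA.subst k.eq.right) hBr (e.tm_right.subst hr) hb) ?_
  rw [Ty.subst_liftSub_inst, Tm.subst_liftSub_inst, Tm.subst_liftSub_inst]
  exact v.2 (k.scons hA vA eab r)

theorem ValidTmEq.app (hA : Derivable (.ty Γ A)) (vA : ValidTyEq Γ A A)
    (vB : ValidTyEq (A :: Γ) B B) (vf : ValidTmEq Γ f f' (.pi A B))
    (ea : Derivable (.tmEq Γ a a' A)) (va : ValidTmEq Γ a a' A) :
    ValidTmEq Γ (.app f a) (.app f' a') (B.inst a) := by
  refine ⟨vB.inst hA (tmEq_refl ea.tm_left) va.left, fun σ τ k => ?_⟩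
  have h := vf.2 k
  rw [rel_pi_subst k hA vA vB] at h
  rw [Ty.inst_subst']
  exact h _ _ (ea.tmEq_subst k.eq) (va.2 k)

/-- `PiRel` observes a function through application alone, and the applied η-expansion reaches the
applied function in one weak head step. -/
theorem ValidTmEq.pi_eta (hA : Derivable (.ty Γ A)) (hB : Derivable (.ty (A :: Γ) B))
    (vA : ValidTyEq Γ A A) (vB : ValidTyEq (A :: Γ) B B)
    (hf : Derivable (.tm Γ f (.pi A B))) (vf : ValidTmEq Γ f f (.pi A B)) :
    ValidTmEq Γ (.lam (.app f.weaken (.var 0))) f (.pi A B) := by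
  refine ⟨vf.1, fun σ τ k => ?_⟩
  have h := vf.2 k
  rw [rel_pi_subst k hA vA vB] at h ⊢
  intro a b e r
  have hA' := hA.subst k.eq.left
  have hB' := hB.subst (k.eq.left.lift hA')
  have step : Tm.Step
      (.app ((Tm.lam (.app f.weaken (.var 0))).subst σ) a) (.app (f.subst σ) a) := by
    have := Tm.Step.beta (.app (f.weaken.subst (liftSub σ)) (.var 0)) a
    simpa only [Tm.inst, Tm.subst, Tm.weaken_subst_liftSub, single_eq_scons,
      Tm.weaken_subst_scons, Tm.subst_var, liftSub, scons] using this
  exact Ty.rel_expand (hB'.ty_inst e.tm_left) step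
    (tmEq_app hA' hB' ((Derivable.pi_eta hA hB hf).subst k.eq.left) (tmEq_refl e.tm_left))
    (h a b e r)

theorem ValidTmEq.fst (hA : Derivable (.ty Γ A)) (vA : ValidTyEq Γ A A)
    (vB : ValidTyEq (A :: Γ) B B) (vp : ValidTmEq Γ p p' (.sigma A B)) :
    ValidTmEq Γ (.fst p) (.fst p') A := by
  refine ⟨vA, fun σ τ k => ?_⟩
  have h := vp.2 k
  rw [rel_sigma_subst k hA vA vB] at h
  exact h.2.1

theorem ValidTmEq.snd (hA : Derivable (.ty Γ A)) (vA : ValidTyEq Γ A A)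
    (vB : ValidTyEq (A :: Γ) B B) (e : Derivable (.tmEq Γ (.fst p) (.fst p') A))
    (vp : ValidTmEq Γ p p' (.sigma A B)) :
    ValidTmEq Γ (.snd p) (.snd p') (B.inst (.fst p)) := by
  refine ⟨vB.inst hA (tmEq_refl e.tm_left) (vp.left.fst hA vA vB), fun σ τ k => ?_⟩
  have h := vp.2 k
  rw [rel_sigma_subst k hA vA vB] at h
  rw [Ty.inst_subst']
  exact h.2.2

/-- Extensionality of the computability relation of a sum. -/
theorem ValidTmEq.sigma_ext (hA : Derivable (.ty Γ A)) (vA : ValidTyEq Γ A A)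
    (vB : ValidTyEq (A :: Γ) B B) (e : Derivable (.tmEq Γ (.fst p) (.fst p') A))
    (v₁ : ValidTmEq Γ (.fst p) (.fst p') A)
    (v₂ : ValidTmEq Γ (.snd p) (.snd p') (B.inst (.fst p))) :
    ValidTmEq Γ p p' (.sigma A B) := by
  refine ⟨.sigma hA (tyEq_refl hA) vA vB, fun σ τ k => ?_⟩
  rw [rel_sigma_subst k hA vA vB]
  refine ⟨e.tmEq_subst k.eq, v₁.2 k, ?_⟩
  have := v₂.2 k
  rwa [Ty.inst_subst'] at this

theorem ValidTmEq.fst_pair (hA : Derivable (.ty Γ A)) (hB : Derivable (.ty (A :: Γ) B))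
    (ha : Derivable (.tm Γ a A)) (hb : Derivable (.tm Γ b (B.inst a)))
    (va : ValidTmEq Γ a a A) : ValidTmEq Γ (.fst (.pair a b)) a A :=
  .of_step (fun _ => .fst_pair _ _) (sigma_beta_fst hA hB ha hb) hA va

theorem ValidTmEq.snd_pair (hA : Derivable (.ty Γ A)) (hB : Derivable (.ty (A :: Γ) B))
    (ha : Derivable (.tm Γ a A)) (hb : Derivable (.tm Γ b (B.inst a)))
    (vb : ValidTmEq Γ b b (B.inst a)) : ValidTmEq Γ (.snd (.pair a b)) b (B.inst a) :=
  .of_step (fun _ => .snd_pair _ _) (sigma_beta_snd hA hB ha hb) (hB.ty_inst ha) vb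

theorem ValidTmEq.pair (hA : Derivable (.ty Γ A)) (hB : Derivable (.ty (A :: Γ) B))
    (vA : ValidTyEq Γ A A) (vB : ValidTyEq (A :: Γ) B B)
    (ea : Derivable (.tmEq Γ a a' A)) (eb : Derivable (.tmEq Γ b b' (B.inst a)))
    (va : ValidTmEq Γ a a' A) (vb : ValidTmEq Γ b b' (B.inst a)) :
    ValidTmEq Γ (.pair a b) (.pair a' b') (.sigma A B) := by
  have hb' := tm_conv eb.tm_right (hB.tyEq_inst ea.tm_left ea.tm_right ea)
  have eaa := vB.inst hA ea va
  have v₁ := fst_pair hA hB ea.tm_left eb.tm_left va.left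
  have v₁' := fst_pair hA hB ea.tm_right hb' va.right
  have v₂ := snd_pair hA hB ea.tm_left eb.tm_left vb.left
  have v₂' := snd_pair hA hB ea.tm_right hb' (vb.right.conv eaa)
  refine sigma_ext hA vA vB (tmEq_fst hA hB (tmEq_pair hA hB ea eb))
    (v₁.trans (va.trans v₁'.symm)) ?_
  -- The chain lives over `B.inst a`, with the right-hand β-step brought back from `B.inst a'`; the
  -- outer conversion moves it to the instance at the first projection of the pair.
  exact (v₂.trans (vb.trans (v₂'.symm.conv eaa.symm))).conv
    (vB.inst hA (tmEq_symm (sigma_beta_fst hA hB ea.tm_left eb.tm_left)) v₁.symm)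

theorem ValidTmEq.sigma_eta (hA : Derivable (.ty Γ A)) (hB : Derivable (.ty (A :: Γ) B))
    (vA : ValidTyEq Γ A A) (vB : ValidTyEq (A :: Γ) B B)
    (hp : Derivable (.tm Γ p (.sigma A B))) (vp : ValidTmEq Γ p p (.sigma A B)) :
    ValidTmEq Γ (.pair (.fst p) (.snd p)) p (.sigma A B) := by
  have h₁ := tm_fst hA hB hp
  have h₂ := tm_snd hA hB hp
  have v := vp.fst hA vA vB
  have v₁ := fst_pair hA hB h₁ h₂ v
  refine sigma_ext hA vA vB (sigma_beta_fst hA hB h₁ h₂) v₁ ?_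
  exact (snd_pair hA hB h₁ h₂ (vp.snd hA vA vB (tmEq_refl h₁))).conv
    (vB.inst hA (tmEq_symm (sigma_beta_fst hA hB h₁ h₂)) v₁.symm)

/-! ### Validity of the rules for the universe -/

/-- Equality of codes is tested at level `∅`. Keeping this level, rather than weakening to the full
one, is what allows product and sum codes to be formed from valid codes. -/
theorem validTmEq_univ_iff : ValidTmEq Γ a b .univ ↔
    ∀ ⦃σ τ : ℕ → Tm⦄, CompSubst Γ σ τ → CompTyEq ∅ (.el (a.subst σ)) (.el (b.subst τ)) := by
  simp only [ValidTmEq, Ty.subst, rel_univ, univRel_iff]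
  exact and_iff_right ValidTyEq.univ

theorem ValidTmEq.el (v : ValidTmEq Γ a b .univ) : ValidTyEq Γ (.el a) (.el b) :=
  fun _ _ k => (validTmEq_univ_iff.1 v k).mono (by simp)

theorem ValidTmEq.el_fam (k : CompSubst Γ σ τ) (ha : Derivable (.tm Γ a .univ))
    (va : ValidTmEq Γ a a .univ) (vb : ValidTmEq (.el a :: Γ) b b' .univ) :
    CompFamEq ∅ (.el (a.subst σ)) (.el (b.subst (liftSub σ)))
      (.el (b'.subst (liftSub τ))) := by
  intro x y e r
  have := validTmEq_univ_iff.1 vb (k.scons (A := .el a) (ty_el ha) va.el e r)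
  rwa [← Tm.subst_liftSub_inst, ← Tm.subst_liftSub_inst] at this

theorem compTyEq_el_ans : CompTyEq ∅ (.el .ansCode) .ans :=
  .of_step (by simp) .ans (el_ans ctx_nil) (compTyEq_ans (by simp)).left

theorem compTyEq_el_pi (ha : Derivable (.tm [] a .univ))
    (hb : Derivable (.tm [.el a] b .univ)) (va : CompTyEq ∅ (.el a) (.el a))
    (vb : CompFamEq ∅ (.el a) (.el b) (.el b)) :
    CompTyEq ∅ (.el (.piCode a b)) (.pi (.el a) (.el b)) :=
  .of_step (by simp) (.pi _ _) (el_pi ha hb)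
    (compTyEq_pi (by simp) (tyEq_refl (ty_el ha)) va vb).left

theorem compTyEq_el_sigma (ha : Derivable (.tm [] a .univ))
    (hb : Derivable (.tm [.el a] b .univ)) (va : CompTyEq ∅ (.el a) (.el a))
    (vb : CompFamEq ∅ (.el a) (.el b) (.el b)) :
    CompTyEq ∅ (.el (.sigmaCode a b)) (.sigma (.el a) (.el b)) :=
  .of_step (by simp) (.sigma _ _) (el_sigma ha hb)
    (compTyEq_sigma (by simp) (tyEq_refl (ty_el ha)) va vb).left

/-- Under `σ` the decoding equation is a weak head step of types; the passage from `σ` to `τ` is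
validity of the resulting product. -/
theorem ValidTyEq.el_pi (ha : Derivable (.tm Γ a .univ))
    (hb : Derivable (.tm (.el a :: Γ) b .univ)) (va : ValidTmEq Γ a a .univ)
    (vb : ValidTmEq (.el a :: Γ) b b .univ) :
    ValidTyEq Γ (.el (.piCode a b)) (.pi (.el a) (.el b)) := fun _ _ k => by
  have hl := k.eq.left.lift (A := .el a) ((ty_el ha).subst k.eq.left)
  have h := compTyEq_el_pi (ha.subst k.eq.left) (hb.subst hl)
    (validTmEq_univ_iff.1 va k.left) (va.el_fam k.left ha vb)
  exact (h.mono (by simp)).trans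
    (ValidTyEq.pi (ty_el ha) (tyEq_refl (ty_el ha)) va.el vb.el k)

theorem ValidTyEq.el_sigma (ha : Derivable (.tm Γ a .univ))
    (hb : Derivable (.tm (.el a :: Γ) b .univ)) (va : ValidTmEq Γ a a .univ)
    (vb : ValidTmEq (.el a :: Γ) b b .univ) :
    ValidTyEq Γ (.el (.sigmaCode a b)) (.sigma (.el a) (.el b)) := fun _ _ k => by
  have hl := k.eq.left.lift (A := .el a) ((ty_el ha).subst k.eq.left)
  have h := compTyEq_el_sigma (ha.subst k.eq.left) (hb.subst hl)
    (validTmEq_univ_iff.1 va k.left) (va.el_fam k.left ha vb)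
  exact (h.mono (by simp)).trans
    (ValidTyEq.sigma (ty_el ha) (tyEq_refl (ty_el ha)) va.el vb.el k)

theorem ValidTmEq.ansCode : ValidTmEq Γ .ansCode .ansCode .univ :=
  validTmEq_univ_iff.2 fun _ _ _ => compTyEq_el_ans.trans compTyEq_el_ans.symm

/-- Both codes decode by one step to products, which are compared at level `∅`. The step on the
right needs `b'` typed over `a'`, hence the context conversion. -/
theorem ValidTmEq.piCode (ha : Derivable (.tm Γ a .univ))
    (ea : Derivable (.tmEq Γ a a' .univ)) (eb : Derivable (.tmEq (.el a :: Γ) b b' .univ))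
    (va : ValidTmEq Γ a a' .univ) (vb : ValidTmEq (.el a :: Γ) b b' .univ) :
    ValidTmEq Γ (.piCode a b) (.piCode a' b') .univ := by
  have hb' := eb.tm_right.tm_ctx_conv (ty_el ea.tm_right) (tyEq_el ea)
  refine validTmEq_univ_iff.2 fun σ τ k => ?_
  have hl := k.eq.left.lift (A := .el a) ((ty_el ha).subst k.eq.left)
  have hr := k.eq.right.lift (A := .el a') ((ty_el ea.tm_right).subst k.eq.right)
  have e := (tyEq_el ea).tyEq_subst k.eq
  have hF := validTmEq_univ_iff.1 va k
  have hG := va.left.el_fam k ha vb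
  have h := compTyEq_el_pi (ha.subst k.eq.left) (eb.tm_left.subst hl)
    (hF.trans hF.symm) hG.left
  have h' := compTyEq_el_pi (ea.tm_right.subst k.eq.right) (hb'.subst hr)
    (hF.symm.trans hF) (hG.right.conv e hF.rel_eq)
  exact h.trans ((compTyEq_pi (by simp) e hF hG).trans h'.symm)

theorem ValidTmEq.sigmaCode (ha : Derivable (.tm Γ a .univ))
    (ea : Derivable (.tmEq Γ a a' .univ)) (eb : Derivable (.tmEq (.el a :: Γ) b b' .univ))
    (va : ValidTmEq Γ a a' .univ) (vb : ValidTmEq (.el a :: Γ) b b' .univ) :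
    ValidTmEq Γ (.sigmaCode a b) (.sigmaCode a' b') .univ := by
  have hb' := eb.tm_right.tm_ctx_conv (ty_el ea.tm_right) (tyEq_el ea)
  refine validTmEq_univ_iff.2 fun σ τ k => ?_
  have hl := k.eq.left.lift (A := .el a) ((ty_el ha).subst k.eq.left)
  have hr := k.eq.right.lift (A := .el a') ((ty_el ea.tm_right).subst k.eq.right)
  have e := (tyEq_el ea).tyEq_subst k.eq
  have hF := validTmEq_univ_iff.1 va k
  have hG := va.left.el_fam k ha vb
  have h := compTyEq_el_sigma (ha.subst k.eq.left) (eb.tm_left.subst hl)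
    (hF.trans hF.symm) hG.left
  have h' := compTyEq_el_sigma (ea.tm_right.subst k.eq.right) (hb'.subst hr)
    (hF.symm.trans hF) (hG.right.conv e hF.rel_eq)
  exact h.trans ((compTyEq_sigma (by simp) e hF hG).trans h'.symm)

end

/-- The fundamental theorem of the computability relations. -/
theorem Derivable.valid {J : Judgement} (h : Derivable J) : J.Valid := by
  induction h <;> simp only [Judgement.Valid] at *
  case ty_ans => exact .ans
  case ty_pi hA _ ihA ihB => exact .pi hA (tyEq_refl hA) ihA ihB
  case ty_sigma hA _ ihA ihB => exact .sigma hA (tyEq_refl hA) ihA ihB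
  case ty_univ => exact .univ
  case ty_el ih => exact ih.el
  case tyEq_refl ih => exact ih
  case tyEq_symm ih => exact ih.symm
  case tyEq_trans ih₁ ih₂ => exact ih₁.trans ih₂
  case tyEq_pi hA e _ _ ihE ihB => exact .pi hA e ihE ihB
  case tyEq_sigma hA e _ _ ihE ihB => exact .sigma hA e ihE ihB
  case tyEq_el ih => exact ih.el
  case el_ans => exact fun _ _ _ => compTyEq_el_ans.mono (by simp)
  case el_pi ha hb va vb => exact .el_pi ha hb va vb
  case el_sigma ha hb va vb => exact .el_sigma ha hb va vb
  case tm_conv iht ihE => exact iht.conv ihE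
  case tm_var hn _ => exact .var hn
  case tm_yes => exact .yes
  case tm_no => exact .no
  case tm_lam hA hB ht ihA _ iht => exact .lam hA hB ihA (tmEq_refl ht) iht
  case tm_app hA _ _ ha ihA ihB ihf iha => exact .app hA ihA ihB ihf (tmEq_refl ha) iha
  case tm_pair hA hB ha hb ihA ihB iha ihb =>
    exact .pair hA hB ihA ihB (tmEq_refl ha) (tmEq_refl hb) iha ihb
  case tm_fst hA _ _ ihA ihB ihp => exact .fst hA ihA ihB ihp
  case tm_snd hA hB hp ihA ihB ihp =>
    exact .snd hA ihA ihB (tmEq_refl (tm_fst hA hB hp)) ihp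
  case tm_ansCode => exact .ansCode
  case tm_piCode ha hb iha ihb => exact .piCode ha (tmEq_refl ha) (tmEq_refl hb) iha ihb
  case tm_sigmaCode ha hb iha ihb => exact .sigmaCode ha (tmEq_refl ha) (tmEq_refl hb) iha ihb
  case tmEq_refl ih => exact ih
  case tmEq_symm ih => exact ih.symm
  case tmEq_trans ih₁ ih₂ => exact ih₁.trans ih₂
  case tmEq_conv iht ihE => exact iht.conv ihE
  case tmEq_lam hA hB et ihA _ iht => exact .lam hA hB ihA et iht
  case tmEq_app hA _ _ ea ihA ihB ihf iha => exact .app hA ihA ihB ihf ea iha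
  case tmEq_pair hA hB ea eb ihA ihB iha ihb => exact .pair hA hB ihA ihB ea eb iha ihb
  case tmEq_fst hA _ _ ihA ihB ihp => exact .fst hA ihA ihB ihp
  case tmEq_snd hA hB ep ihA ihB ihp => exact .snd hA ihA ihB (tmEq_fst hA hB ep) ihp
  case tmEq_piCode ha ea eb _ va vb => exact .piCode ha ea eb va vb
  case tmEq_sigmaCode ha ea eb _ va vb => exact .sigmaCode ha ea eb va vb
  case pi_beta hA hB ht ha _ ihB iht iha =>
    exact .of_step (fun σ => by rw [Tm.inst_subst']; exact .beta _ _) (pi_beta hA hB ht ha)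
      (hB.ty_inst ha) (iht.inst hA (tmEq_refl ha) iha)
  case pi_eta hA hB hf ihA ihB ihf => exact .pi_eta hA hB ihA ihB hf ihf
  case sigma_beta_fst hA hB ha hb _ _ iha _ => exact .fst_pair hA hB ha hb iha
  case sigma_beta_snd hA hB ha hb _ _ _ ihb => exact .snd_pair hA hB ha hb ihb
  case sigma_eta hA hB hp ihA ihB ihp => exact .sigma_eta hA hB ihA ihB hp ihp

/-! ### Canonicity for closed terms -/

theorem compSubst_nil : CompSubst [] .var .var :=
  ⟨.refl (.var ctx_nil), nofun, nofun⟩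

end MLTT

theorem mainTheorem3 (t : MLTT.Tm) (ht : MLTT.Derivable (.tm [] t .ans)) :
    MLTT.Derivable (.tmEq [] t .yes .ans) ∨ MLTT.Derivable (.tmEq [] t .no .ans) := by
  have h := ht.valid.2 MLTT.compSubst_nil
  rw [MLTT.Ty.subst_var, MLTT.Tm.subst_var, MLTT.rel_ans] at h
  exact h.2
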